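/- **Setting.** Let $m\ge 1$ and $n\ge 1$. In the infinite hexagonal lattice, drawn with some edges vertical, a *regular $m$-tier strip of length $n$* $\boldsymbol S$ is the union of $m$ consecutive horizontal rows of adjacent hexagons (each row with at least one hexagon), numbered $1,\dots,m$ from top to bottom, such that the left ends, and likewise the right ends, of any two adjacent rows differ by exactly half a hexagon width, and the top and bottom rows both consist of $n$ hexagons. A *Kekulé structure* is a perfect matching $K$ of $\boldsymbol S$; its edges are called double bonds. Assume that $\boldsymbol S$ has at least one Kekulé structure. Let $i_k$ be the set of vertical edges of row $k$, denote them from left to right by $e_{k,1},e_{k,2},\dots$, and put $\mathrm{ord}(i_k)=|i_k|-n$. Every Kekulé structure $K$ contains exactly $\mathrm{ord}(i_k)$ edges of $i_k$. Let $\mathcal S$ be the set of symbols $s_{k,j}$ with $1\le k\le m$, $1\le j\le \mathrm{ord}(i_k)$, partially ordered by the transitive closure $<_{\mathcal S}$ of the following relation: $s_{k,j}\lessdot s_{k',j'}$ if and only if $|k-k'|=1$ and either $j'=j$ and the leftmost edge of $i_k\cup i_{k'}$ lies in $i_k$, or $j'=j+1$ and the leftmost edge of $i_k\cup i_{k'}$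 lies in $i_{k'}$. For a Kekulé structure $K$, let $\mathrm{pos}_K(s_{k,j})$ be the number $p$ such that $e_{k,p}$ is the $j$-th edge from the left in $K\cap i_k$. A *proper sextet* of $K$ is a hexagon of $\boldsymbol S$ whose right vertical, upper left and lower left edges all belong to $K$. Let $\mathcal A_K\subseteq\mathcal S$ be the set of those $s_{k,j}$ for which $e_{k,\mathrm{pos}_K(s_{k,j})}$ is one of these three edges of a proper sextet of $K$. Subsets of $\mathcal S$ carry the induced order, and $[n]=\{1,\dots,n\}$. **Lemma.** For every $\mathcal A\subseteq\mathcal S$ and every strictly order-preserving map $\mu:\mathcal A\to[n]$ there is exactly one Kekulé structure $K$ of $\boldsymbol S$ such that 1. $\mathrm{pos}_K(s_{k,j})=\mu(s_{k,j})+j$ for every $s_{k,j}\in\mathcal A$, 2. $\mathrm{pos}_K(s_{k,j})=\max\bigl(\{\mu(s_{k',j'}) : s_{k',j'}\in\mathcal A,\ s_{k',j'}<_{\mathcal S}s_{k,j}\}\cup\{0\}\bigr)+j$ for every $s_{k,j}\in\mathcal S\setminus\mathcal A$, 3. $\mathcal A_K=\mathcal A$. Moreover, there is a bijection between the Kekulé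 structures $K$ of $\boldsymbol S$ and the pairs $(\mathcal A,\mu)$ consisting of a subset $\mathcal A\subseteq\mathcal S$ and a strictly order-preserving map $\mu:\mathcal A\to[n]$, under which $K$ and its pair $(\mathcal A,\mu)$ satisfy 1–3. -/

import Mathlib

/-- The infinite hexagonal lattice, oriented so that some of its edges are vertical, in brick-wall
coordinates. The vertex `(x, y)` lies on the `y`-th horizontal zigzag chain (counted from top to
bottom) at horizontal position `x` (measured in half hexagon units). Consecutive vertices of a
zigzag chain are joined by slanted edges, and for `x + y` even the vertical edge at `(x, y)` goes
down to `(x, y + 1)`. -/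
def hexLattice : SimpleGraph (ℤ × ℤ) :=
  SimpleGraph.fromRel fun u v =>
    (v.1 = u.1 + 1 ∧ v.2 = u.2) ∨ (v.1 = u.1 ∧ v.2 = u.2 + 1 ∧ Even (u.1 + u.2))

/-- The six vertices of the lattice hexagon (for `x + y` even) whose left vertical edge joins
`(x, y)` to `(x, y + 1)` and whose right vertical edge joins `(x + 2, y)` to `(x + 2, y + 1)`. Its
top corner is `(x + 1, y)` and its bottom corner is `(x + 1, y + 1)`. -/
def hexagon (x y : ℤ) : Set (ℤ × ℤ) :=
  {(x, y), (x + 1, y), (x + 2, y), (x, y + 1), (x + 1, y + 1), (x + 2, y + 1)}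

/-- The vertical edge of the lattice (for `x + y` even) joining `(x, y)` to `(x, y + 1)`. -/
def verticalEdge (x y : ℤ) : Sym2 (ℤ × ℤ) := s((x, y), (x, y + 1))

/-- The three edges which, when they are all double bonds, form a proper sextet in the hexagon
`hexagon x y`: the right vertical edge, the upper left edge and the lower left edge. -/
def sextetEdges (x y : ℤ) : Set (Sym2 (ℤ × ℤ)) :=
  {verticalEdge (x + 2) y, s((x, y), (x + 1, y)), s((x, y + 1), (x + 1, y + 1))}

/-- A regular `m`-tier benzenoid strip of length `n`: it consists of `m` consecutive horizontal rows
of adjacent hexagons, numbered from top to bottom. Row `k` has `len k` hexagons and the left end of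
its leftmost hexagon is at horizontal position `left k`. The two ends of adjacent rows each differ
by plus or minus half a hexagon unit, and the top and the bottom row both have `n` hexagons. -/
structure RegularStrip (m n : ℕ) where
  /-- horizontal position of the left end of a row -/
  left : Fin m → ℤ
  /-- number of hexagons of a row -/
  len : Fin m → ℕ
  tiers_pos : 1 ≤ m
  len_pos : ∀ k, 1 ≤ len k
  even_left : ∀ k, Even (left k + (k : ℤ))
  left_step : ∀ k l : Fin m, (l : ℕ) = k + 1 → |left l - left k| = 1
  right_step : ∀ k l : Fin m, (l : ℕ) = k + 1 →
    |(left l + 2 * (len l : ℤ)) - (left k + 2 * (len k : ℤ))| = 1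
  len_top : ∀ k : Fin m, (k : ℕ) = 0 → len k = n
  len_bottom : ∀ k : Fin m, (k : ℕ) + 1 = m → len k = n

namespace RegularStrip

variable {m n : ℕ} (S : RegularStrip m n)

/-- The strip as a subgraph of the hexagonal lattice: the union of its hexagons. -/
def graph : hexLattice.Subgraph :=
  ⨆ k : Fin m, ⨆ i : Fin (S.len k),
    (⊤ : hexLattice.Subgraph).induce (hexagon (S.left k + 2 * (i : ℤ)) (k : ℤ))

/-- Kekulé structures: spanning subgraphs of the strip all of whose components are single edges,
i.e. perfect matchings of the strip. -/
structure Kekule where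
  /-- the underlying subgraph; its edges are the double bonds -/
  toSubgraph : hexLattice.Subgraph
  le_graph : toSubgraph ≤ S.graph
  spanning : toSubgraph.verts = S.graph.verts
  isMatching : toSubgraph.IsMatching

/-- The number of interface bonds (vertical edges of the strip) in row `k`. -/
def interfaceCard (k : Fin m) : ℕ := S.len k + 1

/-- The `p`-th bond from the left, `1 ≤ p ≤ S.interfaceCard k`, of the interface in row `k`. -/
def interfaceBond (k : Fin m) (p : ℕ) : Sym2 (ℤ × ℤ) :=
  verticalEdge (S.left k + 2 * ((p : ℤ) - 1)) (k : ℤ)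

/-- The order of the interface in row `k`: its number of bonds minus `n`. -/
def ord (k : Fin m) : ℤ := (S.interfaceCard k : ℤ) - n

/-- The set of double interface bonds (dibs) `s_{k,j}`, `1 ≤ j ≤ ord k`, of the strip. -/
@[ext]
structure Dib where
  /-- the row of the dib -/
  k : Fin m
  /-- the index of the dib within its row, counted from the left, starting with 1 -/
  j : ℕ
  one_le : 1 ≤ j
  le_ord : (j : ℤ) ≤ S.ord k

variable {S}

/-- The relation generating the order of the dibs: `s` and `t` lie in adjacent rows, and the index
of `t` equals that of `s` if the first (leftmost) interface bond of the fragment between these two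
rows lies in the row of `s`, and exceeds it by one if it lies in the row of `t`. -/
def Dib.Cover (s t : S.Dib) : Prop :=
  |(t.k : ℤ) - (s.k : ℤ)| = 1 ∧
    ((S.left s.k < S.left t.k ∧ t.j = s.j) ∨ (S.left t.k < S.left s.k ∧ t.j = s.j + 1))

theorem Dib.Cover.rank {s t : S.Dib} (h : s.Cover t) :
    S.left t.k + 2 * (t.j : ℤ) = S.left s.k + 2 * (s.j : ℤ) + 1 := by
  obtain ⟨h1, h2⟩ := h
  have h3 : |S.left t.k - S.left s.k| = 1 := by
    rcases (abs_eq (by norm_num)).1 h1 with h | h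
    · exact S.left_step s.k t.k (by omega)
    · rw [abs_sub_comm]
      exact S.left_step t.k s.k (by omega)
  rcases (abs_eq (by norm_num)).1 h3 with h | h <;> rcases h2 with ⟨h4, h5⟩ | ⟨h4, h5⟩ <;> omega

theorem Dib.rank_lt {s t : S.Dib} (h : Relation.TransGen Dib.Cover s t) :
    S.left s.k + 2 * (s.j : ℤ) < S.left t.k + 2 * (t.j : ℤ) := by
  induction h with
  | single h => have := h.rank; omega
  | tail _ h ih => have := h.rank; omega

theorem Dib.not_transGen_self (s : S.Dib) : ¬ Relation.TransGen Dib.Cover s s :=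
  fun h => lt_irrefl _ (Dib.rank_lt h)

/-- The poset of dibs: its strict order is the transitive closure of `Dib.Cover`. -/
instance : PartialOrder S.Dib where
  le := Relation.ReflTransGen Dib.Cover
  lt := Relation.TransGen Dib.Cover
  le_refl _ := Relation.ReflTransGen.refl
  le_trans _ _ _ := Relation.ReflTransGen.trans
  lt_iff_le_not_ge s t := by
    constructor
    · intro h
      exact ⟨h.to_reflTransGen, fun h' => Dib.not_transGen_self s (h.trans_left h')⟩
    · rintro ⟨h, h'⟩
      rcases Relation.reflTransGen_iff_eq_or_transGen.1 h with rfl | h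
      · exact absurd Relation.ReflTransGen.refl h'
      · exact h
  le_antisymm s t h h' := by
    rcases Relation.reflTransGen_iff_eq_or_transGen.1 h with rfl | h
    · rfl
    · exact absurd (h.trans_left h') (Dib.not_transGen_self s)

namespace Kekule

variable (K : S.Kekule)

/-- The `p`-th bond of the interface in row `k` exists and is a double bond of `K`. -/
def IsDoubleAt (k : Fin m) (p : ℕ) : Prop :=
  1 ≤ p ∧ p ≤ S.interfaceCard k ∧ S.interfaceBond k p ∈ K.toSubgraph.edgeSet

/-- The position `pos_K s` of the dib `s = s_{k,j}` in `K`: the index in the interface of row `k`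
of the `j`-th double bond of `K` from the left in this interface. -/
noncomputable def pos (s : S.Dib) : ℕ := Nat.nth (K.IsDoubleAt s.k) (s.j - 1)

/-- The interface bond of the strip corresponding to the dib `s` in `K`. -/
noncomputable def bond (s : S.Dib) : Sym2 (ℤ × ℤ) := S.interfaceBond s.k (K.pos s)

/-- The dibs whose bonds participate in a proper sextet of `K`. -/
def properDibs : Set S.Dib :=
  {s | ∃ k : Fin m, ∃ i : Fin (S.len k),
    sextetEdges (S.left k + 2 * (i : ℤ)) (k : ℤ) ⊆ K.toSubgraph.edgeSet ∧
    K.bond s ∈ sextetEdges (S.left k + 2 * (i : ℤ)) (k : ℤ)}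

/-- `K` corresponds to the pair of `A` and `μ`: the positions of the dibs in `A` are `μ + j`, the
positions of the other dibs are `j` plus the maximum of `0` and the values of `μ` on the smaller
dibs in `A`, and `A` is the set of dibs participating in proper sextets of `K`. -/
def Corresponds (A : Set S.Dib) (μ : A → Set.Icc 1 n) : Prop :=
  (∀ s : A, K.pos s = (μ s : ℕ) + (s : S.Dib).j) ∧
  (∀ s : S.Dib, s ∉ A → ∃ M : ℕ,
    IsGreatest ({v : ℕ | ∃ t : A, (t : S.Dib) < s ∧ (μ t : ℕ) = v} ∪ {0}) M ∧
    K.pos s = M + s.j) ∧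
  K.properDibs = A

end Kekule

end RegularStrip

/-! For each row, count the vertical double bonds up to a given horizontal position. Summing the
matching condition along a zigzag chain with alternating signs expresses every slanted bond through
the counts of the two rows next to the chain (`chain_identity`). Hence the counts determine the
Kekulé structure and interlace in adjacent rows; conversely, interlacing counts with the right
totals come from a Kekulé structure (`exists_kekule_of_counts`).

Write the position of a dib `s` as `shift s + j`. The shifts lie in {0,…,n}, and interlacing amounts
to their being order preserving (`shift_mono`, `exists_kekule_of_shift`). So Kekulé structures are
the order-preserving maps h from the poset of dibs to {0,…,n}. A dib lies in a proper sextet iff its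
shift is positive and exceeds that of every dib directly below it (`mem_properDibs_iff`).

The rest holds for any finite poset: h is encoded by the set A where it is positive and larger than
at all smaller elements, together with its restriction μ to A, because h(s) is the maximum of 0 and
the μ(t) with t ≤ s in A (`exists_mem_properDibs`). Every strictly order-preserving μ with values in
[n] arises in this way (`exists_corresponds`). -/

namespace RegularStrip

variable {m n : ℕ} (S : RegularStrip m n)

/-! ### Row ends, with virtual rows above and below the strip -/

/-- Left end of the rows `-1, 0, …, m`, where a virtual row of one hexagon less is put above the
top row and below the bottom row. -/
def extLeft (y : ℤ) : ℤ :=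
  if h : 0 ≤ y ∧ y < m then S.left ⟨y.toNat, by omega⟩
  else if y < 0 then S.left ⟨0, S.tiers_pos⟩ + 1
  else S.left ⟨m - 1, Nat.sub_lt S.tiers_pos one_pos⟩ + 1

/-- Right end of the rows `-1, 0, …, m`, with the same virtual rows as for `extLeft`. -/
def extRight (y : ℤ) : ℤ :=
  if h : 0 ≤ y ∧ y < m then S.left ⟨y.toNat, by omega⟩ + 2 * (S.len ⟨y.toNat, by omega⟩ : ℤ)
  else if y < 0 then S.left ⟨0, S.tiers_pos⟩ + 2 * (S.len ⟨0, S.tiers_pos⟩ : ℤ) - 1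
  else S.left ⟨m - 1, Nat.sub_lt S.tiers_pos one_pos⟩ +
    2 * (S.len ⟨m - 1, Nat.sub_lt S.tiers_pos one_pos⟩ : ℤ) - 1

theorem extLeft_coe (k : Fin m) : S.extLeft (k : ℤ) = S.left k := by
  have : (0 : ℤ) ≤ (k : ℤ) ∧ (k : ℤ) < m := ⟨by omega, by have := k.2; omega⟩
  simp [extLeft, this]

theorem extRight_coe (k : Fin m) : S.extRight (k : ℤ) = S.left k + 2 * (S.len k : ℤ) := by
  have : (0 : ℤ) ≤ (k : ℤ) ∧ (k : ℤ) < m := ⟨by omega, by have := k.2; omega⟩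
  simp [extRight, this]

theorem exists_row {y : ℤ} (h0 : 0 ≤ y) (h1 : y < m) : ∃ k : Fin m, (k : ℤ) = y :=
  ⟨⟨y.toNat, by omega⟩, by simp [h0]⟩

theorem extLeft_neg_one : S.extLeft (-1) = S.extLeft 0 + 1 := by
  have := S.tiers_pos
  have h : (0 : ℤ) < m := by omega
  simp [extLeft]
  omega

theorem extRight_neg_one : S.extRight (-1) = S.extRight 0 - 1 := by
  have := S.tiers_pos
  have h : (0 : ℤ) < m := by omega
  simp [extRight]
  omega

theorem extLeft_last : S.extLeft m = S.extLeft (m - 1) + 1 := by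
  have h := S.extLeft_coe ⟨m - 1, Nat.sub_lt S.tiers_pos one_pos⟩
  have := S.tiers_pos
  push_cast [this] at h
  rw [h]
  simp [extLeft]

theorem extRight_last : S.extRight m = S.extRight (m - 1) - 1 := by
  have h := S.extRight_coe ⟨m - 1, Nat.sub_lt S.tiers_pos one_pos⟩
  have := S.tiers_pos
  push_cast [this] at h
  rw [h]
  simp [extRight]

theorem extLeft_step {y : ℤ} (h0 : 0 ≤ y) (h1 : y ≤ m) :
    S.extLeft y = S.extLeft (y - 1) + 1 ∨ S.extLeft y = S.extLeft (y - 1) - 1 := by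
  rcases eq_or_lt_of_le h0 with rfl | h0
  · right; have := S.extLeft_neg_one; simp [this]
  rcases eq_or_lt_of_le h1 with rfl | h1
  · left; exact S.extLeft_last
  obtain ⟨k, hk⟩ := exists_row (m := m) (y := y) (by omega) h1
  obtain ⟨l, hl⟩ := exists_row (m := m) (y := y - 1) (by omega) (by omega)
  have := S.left_step l k (by omega)
  rw [← hl, ← hk, extLeft_coe, extLeft_coe]
  rcases (abs_eq (by norm_num)).1 this with h | h <;> omega

theorem extRight_step {y : ℤ} (h0 : 0 ≤ y) (h1 : y ≤ m) :
    S.extRight y = S.extRight (y - 1) + 1 ∨ S.extRight y = S.extRight (y - 1) - 1 := by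
  rcases eq_or_lt_of_le h0 with rfl | h0
  · left; have := S.extRight_neg_one; simp [this]
  rcases eq_or_lt_of_le h1 with rfl | h1
  · right; exact S.extRight_last
  obtain ⟨k, hk⟩ := exists_row (m := m) (y := y) (by omega) h1
  obtain ⟨l, hl⟩ := exists_row (m := m) (y := y - 1) (by omega) (by omega)
  have := S.right_step l k (by omega)
  rw [← hl, ← hk, extRight_coe, extRight_coe]
  rcases (abs_eq (by norm_num)).1 this with h | h <;> omega

theorem extLeft_add_two_le {y : ℤ} (h0 : 0 ≤ y) (h1 : y < m) :
    S.extLeft y + 2 ≤ S.extRight y := by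
  obtain ⟨k, rfl⟩ := exists_row h0 h1
  have := S.len_pos k
  rw [extLeft_coe, extRight_coe]
  omega

theorem extLeft_parity {y : ℤ} (h0 : -1 ≤ y) (h1 : y ≤ m) : (S.extLeft y + y) % 2 = 0 := by
  have key : ∀ z : ℤ, 0 ≤ z → z < m → (S.extLeft z + z) % 2 = 0 := by
    intro z hz hz'
    obtain ⟨k, rfl⟩ := exists_row hz hz'
    rw [extLeft_coe, ← Int.even_iff]
    exact S.even_left k
  have := S.tiers_pos
  rcases eq_or_lt_of_le h0 with rfl | h0
  · have h2 := key 0 le_rfl (by omega)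
    rw [extLeft_neg_one]; omega
  rcases eq_or_lt_of_le h1 with rfl | h1
  · have h2 := key (m - 1) (by omega) (by omega)
    rw [extLeft_last]; omega
  · exact key y (by omega) h1

theorem extRight_parity {y : ℤ} (h0 : -1 ≤ y) (h1 : y ≤ m) : (S.extRight y + y) % 2 = 0 := by
  have key : ∀ z : ℤ, 0 ≤ z → z < m → (S.extRight z + z) % 2 = 0 := by
    intro z hz hz'
    have h := S.extLeft_parity (y := z) (by omega) (by omega)
    obtain ⟨k, rfl⟩ := exists_row hz hz'
    rw [extLeft_coe] at h
    rw [extRight_coe]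
    omega
  have := S.tiers_pos
  rcases eq_or_lt_of_le h0 with rfl | h0
  · have h2 := key 0 le_rfl (by omega)
    rw [extRight_neg_one]; omega
  rcases eq_or_lt_of_le h1 with rfl | h1
  · have h2 := key (m - 1) (by omega) (by omega)
    rw [extRight_last]; omega
  · exact key y (by omega) h1

/-- The virtual row has n - 1 hexagons, so its order would be 0, matching its lack of double bonds.
This starts the induction in `two_mul_vertCount`. -/
theorem extRight_sub_extLeft_neg_one : S.extRight (-1) - S.extLeft (-1) = 2 * n - 2 := by
  have h := S.len_top ⟨0, S.tiers_pos⟩ rfl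
  have h1 := S.extLeft_coe ⟨0, S.tiers_pos⟩
  have h2 := S.extRight_coe ⟨0, S.tiers_pos⟩
  have h3 := S.extLeft_neg_one
  have h4 := S.extRight_neg_one
  simp only [Nat.cast_zero] at h1 h2
  omega

theorem ord_eq (k : Fin m) : 2 * S.ord k = S.extRight k - S.extLeft k + 2 - 2 * n := by
  rw [extLeft_coe, extRight_coe, ord, interfaceCard]
  push_cast
  ring

/-- Left end of the horizontal zigzag chain between the rows `y - 1` and `y`. -/
def chainLeft (y : ℤ) : ℤ := min (S.extLeft (y - 1)) (S.extLeft y)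

/-- Right end of the horizontal zigzag chain between the rows `y - 1` and `y`. -/
def chainRight (y : ℤ) : ℤ := max (S.extRight (y - 1)) (S.extRight y)

end RegularStrip

/-! ### Vertices and edges of the strip in coordinates -/

theorem hexLattice_adj (x y x' y' : ℤ) : hexLattice.Adj (x, y) (x', y') ↔
    (y' = y ∧ (x' = x + 1 ∨ x = x' + 1)) ∨
    (x' = x ∧ ((y' = y + 1 ∧ Even (x + y)) ∨ (y = y' + 1 ∧ Even (x' + y')))) := by
  simp only [hexLattice, SimpleGraph.fromRel_adj, ne_eq, Prod.mk.injEq, Int.even_iff]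
  omega

namespace RegularStrip

variable {m n : ℕ} (S : RegularStrip m n)

theorem mem_graph_verts_iff_row (x y : ℤ) : (x, y) ∈ S.graph.verts ↔
    ∃ k : Fin m, (y = k ∨ y = k + 1) ∧ S.left k ≤ x ∧ x ≤ S.left k + 2 * (S.len k : ℤ) := by
  simp only [graph, SimpleGraph.Subgraph.verts_iSup, SimpleGraph.Subgraph.induce_verts, hexagon,
    Set.mem_iUnion, Set.mem_insert_iff, Set.mem_singleton_iff, Prod.mk.injEq]
  refine exists_congr fun k => ?_
  constructor
  · rintro ⟨i, hi⟩
    have := i.2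
    omega
  · rintro ⟨hy, h1, h2⟩
    have := S.len_pos k
    refine ⟨⟨min ((x - S.left k) / 2).toNat (S.len k - 1), by omega⟩, ?_⟩
    simp only
    omega

theorem mem_graph_verts (x y : ℤ) : (x, y) ∈ S.graph.verts ↔
    0 ≤ y ∧ y ≤ m ∧ S.chainLeft y ≤ x ∧ x ≤ S.chainRight y := by
  rw [mem_graph_verts_iff_row]
  have hm := S.tiers_pos
  constructor
  · rintro ⟨k, hy, h1, h2⟩
    have := k.2
    rw [← extLeft_coe] at h1
    rw [← extRight_coe] at h2
    rw [chainLeft, chainRight]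
    rcases hy with rfl | rfl
    · omega
    · simp only [add_sub_cancel_right]
      omega
  · rintro ⟨h0, h1, h2, h3⟩
    have hL := S.extLeft_step h0 h1
    have hR := S.extRight_step h0 h1
    have key : ∃ z : ℤ, 0 ≤ z ∧ z < m ∧ (y = z ∨ y = z + 1) ∧ S.extLeft z ≤ x ∧
        x ≤ S.extRight z := by
      rw [chainLeft] at h2
      rw [chainRight] at h3
      rcases eq_or_lt_of_le h0 with rfl | h0
      · have h4 := S.extLeft_neg_one
        have h5 := S.extRight_neg_one
        simp only [zero_sub] at *
        exact ⟨0, by omega⟩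
      rcases eq_or_lt_of_le h1 with rfl | h1
      · have h4 := S.extLeft_last
        have h5 := S.extRight_last
        exact ⟨m - 1, by omega⟩
      have h6 := S.extLeft_add_two_le (y := y) (by omega) h1
      have h7 := S.extLeft_add_two_le (y := y - 1) (by omega) (by omega)
      -- The two rows overlap and their ends differ by one, so a position of the chain outside row
      -- `y` lies in row `y - 1`.
      by_cases h8 : S.extLeft y ≤ x ∧ x ≤ S.extRight y
      · exact ⟨y, by omega⟩
      · exact ⟨y - 1, by omega⟩
    obtain ⟨z, hz0, hz1, hz⟩ := key
    obtain ⟨k, rfl⟩ := exists_row hz0 hz1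
    rw [extLeft_coe, extRight_coe] at hz
    exact ⟨k, hz⟩

theorem graph_adj (u v : ℤ × ℤ) : S.graph.Adj u v ↔ ∃ k : Fin m, ∃ i : Fin (S.len k),
    u ∈ hexagon (S.left k + 2 * (i : ℤ)) k ∧ v ∈ hexagon (S.left k + 2 * (i : ℤ)) k ∧
      hexLattice.Adj u v := by
  simp [graph]

theorem graph_adj_right (x y : ℤ) : S.graph.Adj (x, y) (x + 1, y) ↔
    0 ≤ y ∧ y ≤ m ∧ S.chainLeft y ≤ x ∧ x + 1 ≤ S.chainRight y := by
  have hm := S.tiers_pos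
  constructor
  · intro h
    have h1 := (S.mem_graph_verts _ _).1 (S.graph.edge_vert h)
    have h2 := (S.mem_graph_verts _ _).1 (S.graph.edge_vert h.symm)
    omega
  · rintro ⟨h0, h1, h2, h3⟩
    have hL := S.extLeft_step h0 h1
    have hR := S.extRight_step h0 h1
    have key : ∃ z : ℤ, 0 ≤ z ∧ z < m ∧ (y = z ∨ y = z + 1) ∧ S.extLeft z ≤ x ∧
        x + 1 ≤ S.extRight z := by
      rw [chainLeft] at h2
      rw [chainRight] at h3
      rcases eq_or_lt_of_le h0 with rfl | h0
      · have h4 := S.extLeft_neg_one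
        have h5 := S.extRight_neg_one
        simp only [zero_sub] at *
        exact ⟨0, by omega⟩
      rcases eq_or_lt_of_le h1 with rfl | h1
      · have h4 := S.extLeft_last
        have h5 := S.extRight_last
        exact ⟨m - 1, by omega⟩
      have h6 := S.extLeft_add_two_le (y := y) (by omega) h1
      have h7 := S.extLeft_add_two_le (y := y - 1) (by omega) (by omega)
      by_cases h8 : S.extLeft y ≤ x ∧ x + 1 ≤ S.extRight y
      · exact ⟨y, by omega⟩
      · exact ⟨y - 1, by omega⟩
    obtain ⟨z, hz0, hz1, hz⟩ := key
    obtain ⟨k, rfl⟩ := exists_row hz0 hz1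
    rw [extLeft_coe, extRight_coe] at hz
    rw [graph_adj]
    refine ⟨k, ⟨((x - S.left k) / 2).toNat, by omega⟩, ?_, ?_, ?_⟩
    · simp only [hexagon, Set.mem_insert_iff, Set.mem_singleton_iff, Prod.mk.injEq]
      omega
    · simp only [hexagon, Set.mem_insert_iff, Set.mem_singleton_iff, Prod.mk.injEq]
      omega
    · simp [hexLattice_adj]

theorem graph_adj_down (x y : ℤ) : S.graph.Adj (x, y) (x, y + 1) ↔
    0 ≤ y ∧ y < m ∧ (x + y) % 2 = 0 ∧ S.extLeft y ≤ x ∧ x ≤ S.extRight y := by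
  rw [graph_adj]
  simp only [hexLattice_adj, Int.even_iff, hexagon, Set.mem_insert_iff, Set.mem_singleton_iff,
    Prod.mk.injEq]
  constructor
  · rintro ⟨k, i, h1, h2, h3⟩
    have := k.2
    have := i.2
    have hy : y = k := by omega
    subst hy
    rw [extLeft_coe, extRight_coe]
    omega
  · rintro ⟨h0, h1, h2, h3, h4⟩
    have h5 := S.extLeft_parity (y := y) (by omega) (by omega)
    obtain ⟨k, rfl⟩ := exists_row h0 h1
    rw [extLeft_coe] at h3 h5
    rw [extRight_coe] at h4
    have := S.len_pos k
    obtain ⟨i, hi, hx⟩ : ∃ i : ℕ, i < S.len k ∧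
        (x = S.left k + 2 * (i : ℤ) ∨ x = S.left k + 2 * (i : ℤ) + 2) :=
      ⟨min ((x - S.left k) / 2).toNat (S.len k - 1), by omega, by omega⟩
    refine ⟨k, ⟨i, hi⟩, ?_⟩
    refine ⟨?_, ?_, Or.inr ⟨trivial, Or.inl ⟨trivial, h2⟩⟩⟩
    · rcases hx with hx | hx <;> simp [hx]
    · rcases hx with hx | hx <;> simp [hx]

end RegularStrip

/-! ### Counts of vertical double bonds and their interlacing -/

namespace RegularStrip

variable {m n : ℕ} {S : RegularStrip m n}

namespace Kekule

variable (K : S.Kekule)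

open Classical in
/-- The indicator of the vertical double bonds of `K`. -/
noncomputable def vert (y x : ℤ) : ℤ := if K.toSubgraph.Adj (x, y) (x, y + 1) then 1 else 0

open Classical in
/-- The indicator of the slanted double bonds of `K`. -/
noncomputable def horiz (y x : ℤ) : ℤ := if K.toSubgraph.Adj (x, y) (x + 1, y) then 1 else 0

/-- The number of vertical double bonds of `K` in row `y` at horizontal position at most `x`. -/
noncomputable def vertCount (y x : ℤ) : ℤ := ∑ z ∈ Finset.Icc (S.extLeft y) x, K.vert y z

theorem vert_eq_one {y x : ℤ} : K.vert y x = 1 ↔ K.toSubgraph.Adj (x, y) (x, y + 1) := by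
  simp [vert]

theorem horiz_eq_one {y x : ℤ} : K.horiz y x = 1 ↔ K.toSubgraph.Adj (x, y) (x + 1, y) := by
  simp [horiz]

theorem vert_eq_zero_or_one (y x : ℤ) : K.vert y x = 0 ∨ K.vert y x = 1 := by
  unfold vert; split_ifs <;> simp

theorem horiz_eq_zero_or_one (y x : ℤ) : K.horiz y x = 0 ∨ K.horiz y x = 1 := by
  unfold horiz; split_ifs <;> simp

theorem of_vert_eq_one {y x : ℤ} (h : K.vert y x = 1) :
    0 ≤ y ∧ y < m ∧ (x + y) % 2 = 0 ∧ S.extLeft y ≤ x ∧ x ≤ S.extRight y :=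
  (S.graph_adj_down x y).1 (K.le_graph.2 (K.vert_eq_one.1 h))

theorem of_horiz_eq_one {y x : ℤ} (h : K.horiz y x = 1) :
    0 ≤ y ∧ y ≤ m ∧ S.chainLeft y ≤ x ∧ x + 1 ≤ S.chainRight y :=
  (S.graph_adj_right x y).1 (K.le_graph.2 (K.horiz_eq_one.1 h))

theorem vert_add_horiz {y x : ℤ} (h0 : 0 ≤ y) (h1 : y ≤ m) (h2 : S.chainLeft y ≤ x)
    (h3 : x ≤ S.chainRight y) :
    K.vert y x + K.vert (y - 1) x + K.horiz y x + K.horiz y (x - 1) = 1 := by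
  have hv : (x, y) ∈ K.toSubgraph.verts := by
    rw [K.spanning, S.mem_graph_verts]; exact ⟨h0, h1, h2, h3⟩
  obtain ⟨⟨x', y'⟩, hw, huniq⟩ := K.isMatching hv
  have e1 : K.vert y x = 1 ↔ x' = x ∧ y' = y + 1 := by
    rw [vert_eq_one]
    constructor
    · intro h; have := huniq _ h; simp only [Prod.mk.injEq] at this; omega
    · rintro ⟨rfl, rfl⟩; exact hw
  have e2 : K.vert (y - 1) x = 1 ↔ x' = x ∧ y' = y - 1 := by
    rw [vert_eq_one, sub_add_cancel]
    constructor
    · intro h; have := huniq _ h.symm; simp only [Prod.mk.injEq] at this; omega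
    · rintro ⟨rfl, rfl⟩; exact hw.symm
  have e3 : K.horiz y x = 1 ↔ x' = x + 1 ∧ y' = y := by
    rw [horiz_eq_one]
    constructor
    · intro h; have := huniq _ h; simp only [Prod.mk.injEq] at this; omega
    · rintro ⟨rfl, rfl⟩; exact hw
  have e4 : K.horiz y (x - 1) = 1 ↔ x' = x - 1 ∧ y' = y := by
    rw [horiz_eq_one, sub_add_cancel]
    constructor
    · intro h; have := huniq _ h.symm; simp only [Prod.mk.injEq] at this; omega
    · rintro ⟨rfl, rfl⟩; exact hw.symm
  have hadj := (hexLattice_adj x y x' y').1 hw.adj_sub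
  have z1 := K.vert_eq_zero_or_one y x
  have z2 := K.vert_eq_zero_or_one (y - 1) x
  have z3 := K.horiz_eq_zero_or_one y x
  have z4 := K.horiz_eq_zero_or_one y (x - 1)
  omega

theorem vertCount_eq_zero {y x : ℤ} (h : x < S.extLeft y) : K.vertCount y x = 0 := by
  simp [vertCount, Finset.Icc_eq_empty (not_le.2 h)]

theorem vertCount_sub_one (y x : ℤ) : K.vertCount y x = K.vertCount y (x - 1) + K.vert y x := by
  rcases lt_or_ge x (S.extLeft y) with h | h
  · rw [K.vertCount_eq_zero h, K.vertCount_eq_zero (by omega)]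
    rcases K.vert_eq_zero_or_one y x with h' | h'
    · omega
    · have := K.of_vert_eq_one h'; omega
  · have : Finset.Icc (S.extLeft y) x = insert x (Finset.Icc (S.extLeft y) (x - 1)) := by
      ext z; simp only [Finset.mem_insert, Finset.mem_Icc]; omega
    rw [vertCount, this, Finset.sum_insert (by simp), vertCount, add_comm]

theorem vertCount_mono (y : ℤ) : Monotone (K.vertCount y) := by
  refine monotone_int_of_le_succ fun x => ?_
  have h := K.vertCount_sub_one y (x + 1)
  rw [add_sub_cancel_right] at h
  rcases K.vert_eq_zero_or_one y (x + 1) with h' | h' <;> omega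

theorem vertCount_of_row {y : ℤ} (h : y < 0 ∨ m ≤ y) (x : ℤ) : K.vertCount y x = 0 := by
  refine Finset.sum_eq_zero fun z _ => ?_
  rcases K.vert_eq_zero_or_one y z with h' | h'
  · exact h'
  · have := K.of_vert_eq_one h'; omega

theorem vertCount_const {y x : ℤ} (h : S.extRight y ≤ x) :
    K.vertCount y x = K.vertCount y (S.extRight y) := by
  induction x, h using Int.leInduction with
  | base => rfl
  | succ x hx ih =>
    rw [vertCount_sub_one, add_sub_cancel_right, ih]
    rcases K.vert_eq_zero_or_one y (x + 1) with h' | h'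
    · omega
    · have := K.of_vert_eq_one h'; omega

theorem horiz_chainRight (y : ℤ) : K.horiz y (S.chainRight y) = 0 := by
  rcases K.horiz_eq_zero_or_one y (S.chainRight y) with h' | h'
  · exact h'
  · have := K.of_horiz_eq_one h'; omega

/-- Along a zigzag chain, the slanted double bonds are determined by the numbers of vertical double
bonds in the two rows adjacent to the chain. -/
theorem chain_identity {y x : ℤ} (h0 : 0 ≤ y) (h1 : y ≤ m) (h2 : S.chainLeft y - 1 ≤ x)
    (h3 : x ≤ S.chainRight y) :
    ((x + y) % 2 = 0 → K.vertCount y x - K.vertCount (y - 1) x + K.horiz y x =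
      if S.extLeft y < S.extLeft (y - 1) then 1 else 0) ∧
    ((x + y) % 2 = 1 → K.vertCount (y - 1) x - K.vertCount y x + K.horiz y x =
      if S.extLeft (y - 1) < S.extLeft y then 1 else 0) := by
  have hstep := S.extLeft_step h0 h1
  have hp := S.extLeft_parity (y := y) (by omega) h1
  induction x, h2 using Int.leInduction with
  | base =>
    -- Just left of the chain all terms are 0, and the parity there selects the case whose
    -- right-hand side is 0.
    have hz : K.horiz y (S.chainLeft y - 1) = 0 := by
      rcases K.horiz_eq_zero_or_one y (S.chainLeft y - 1) with h' | h'
      · exact h'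
      · have := K.of_horiz_eq_one h'; omega
    rw [hz, K.vertCount_eq_zero (by rw [chainLeft]; omega),
      K.vertCount_eq_zero (by rw [chainLeft]; omega), chainLeft]
    constructor <;> intro h <;> split_ifs <;> omega
  | succ x hx ih =>
    have ih := ih (by omega)
    -- By parity only one of the two vertical bonds at this vertex can exist, so its matching
    -- condition carries one parity case into the other.
    have h4 := K.vert_add_horiz (x := x + 1) h0 h1 (by omega) h3
    have h5 := K.vertCount_sub_one y (x + 1)
    have h6 := K.vertCount_sub_one (y - 1) (x + 1)
    rw [add_sub_cancel_right] at h4 h5 h6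
    have h7 : K.vert y (x + 1) = 1 → (x + 1 + y) % 2 = 0 := fun h => (K.of_vert_eq_one h).2.2.1
    have h8 : K.vert (y - 1) (x + 1) = 1 → (x + 1 + (y - 1)) % 2 = 0 :=
      fun h => (K.of_vert_eq_one h).2.2.1
    have z1 := K.vert_eq_zero_or_one y (x + 1)
    have z2 := K.vert_eq_zero_or_one (y - 1) (x + 1)
    constructor <;> intro h <;> split_ifs at ih ⊢ <;> omega

/-- The chain between the adjacent rows `y` and `y'` is chain `max y y'`. -/
theorem horiz_eq {y y' x : ℤ} (h : y' = y + 1 ∨ y = y' + 1) (h0 : 0 ≤ max y y')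
    (h1 : max y y' ≤ m) (h2 : S.chainLeft (max y y') - 1 ≤ x) (h3 : x ≤ S.chainRight (max y y'))
    (hx : (x + y) % 2 = 0) :
    K.vertCount y x - K.vertCount y' x + K.horiz (max y y') x =
      if S.extLeft y < S.extLeft y' then 1 else 0 := by
  rcases h with rfl | rfl
  · have e : max y (y + 1) = y + 1 := by omega
    rw [e] at h0 h1 h2 h3 ⊢
    have := (K.chain_identity h0 h1 h2 h3).2 (by omega)
    rwa [add_sub_cancel_right] at this
  · have e : max (y' + 1) y' = y' + 1 := by omega
    rw [e] at h0 h1 h2 h3 ⊢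
    have := (K.chain_identity h0 h1 h2 h3).1 (by omega)
    rwa [add_sub_cancel_right] at this

/-- The vertical double bonds of adjacent rows interlace. -/
theorem interlace_chain {y : ℤ} (h0 : 0 ≤ y) (h1 : y ≤ m) (x : ℤ) :
    (S.extLeft y < S.extLeft (y - 1) → K.vertCount (y - 1) x ≤ K.vertCount y x ∧
      K.vertCount y x ≤ K.vertCount (y - 1) x + 1) ∧
    (S.extLeft (y - 1) < S.extLeft y → K.vertCount y x ≤ K.vertCount (y - 1) x ∧
      K.vertCount (y - 1) x ≤ K.vertCount y x + 1) := by
  rcases lt_or_ge x (S.chainLeft y - 1) with hx | hx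
  · rw [chainLeft] at hx
    rw [K.vertCount_eq_zero (by omega), K.vertCount_eq_zero (by omega)]
    omega
  have key : ∀ z, S.chainLeft y - 1 ≤ z → z ≤ S.chainRight y →
      (S.extLeft y < S.extLeft (y - 1) → K.vertCount (y - 1) z ≤ K.vertCount y z ∧
        K.vertCount y z ≤ K.vertCount (y - 1) z + 1) ∧
      (S.extLeft (y - 1) < S.extLeft y → K.vertCount y z ≤ K.vertCount (y - 1) z ∧
        K.vertCount (y - 1) z ≤ K.vertCount y z + 1) := by
    intro z hz hz'
    have h := K.chain_identity h0 h1 hz hz'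
    have := K.horiz_eq_zero_or_one y z
    split_ifs at h <;> omega
  rcases le_or_gt x (S.chainRight y) with hx' | hx'
  · exact key x hx hx'
  -- Beyond the chain both counts have reached their totals, so the right end of the chain decides.
  · have hL : S.chainLeft y - 1 ≤ S.chainRight y := by
      have h4 := S.extLeft_step h0 h1
      have h5 := S.extRight_step h0 h1
      have hm := S.tiers_pos
      rw [chainLeft, chainRight]
      rcases eq_or_lt_of_le h1 with rfl | h1
      · have := S.extLeft_add_two_le (y := m - 1) (by omega) (by omega); omega
      · have := S.extLeft_add_two_le (y := y) (by omega) (by omega); omega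
    have := key _ hL le_rfl
    rw [chainRight] at this hx'
    rw [K.vertCount_const (y := y) (x := x) (by omega),
      K.vertCount_const (y := y - 1) (x := x) (by omega)]
    rwa [K.vertCount_const (y := y) (x := max _ _) (by omega),
      K.vertCount_const (y := y - 1) (x := max _ _) (by omega)] at this

theorem interlace {y y' : ℤ} (h : y' = y + 1 ∨ y = y' + 1) (h0 : 0 ≤ max y y')
    (h1 : max y y' ≤ m) (hL : S.extLeft y < S.extLeft y') (x : ℤ) :
    K.vertCount y' x ≤ K.vertCount y x ∧ K.vertCount y x ≤ K.vertCount y' x + 1 := by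
  rcases h with rfl | rfl
  · have := (K.interlace_chain (y := y + 1) (by omega) (by omega) x).2
    rw [add_sub_cancel_right] at this
    exact this hL
  · have := (K.interlace_chain (y := y' + 1) (by omega) (by omega) x).1
    rw [add_sub_cancel_right] at this
    exact this hL

/-- The number of vertical double bonds in a row. -/
theorem two_mul_vertCount {y : ℤ} (h0 : -1 ≤ y) (h1 : y ≤ m) :
    2 * K.vertCount y (S.extRight y) = S.extRight y - S.extLeft y + 2 - 2 * n := by
  induction y, h0 using Int.leInduction with
  | base =>
    have := S.extRight_sub_extLeft_neg_one
    rw [K.vertCount_of_row (by omega)]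
    omega
  | succ y hy ih =>
    have ih := ih (by omega)
    have hL := S.extLeft_step (y := y + 1) (by omega) h1
    have hR := S.extRight_step (y := y + 1) (by omega) h1
    have hpR := S.extRight_parity (y := y) (by omega) (by omega)
    have hpL := S.extLeft_parity (y := y) (by omega) (by omega)
    have hC : S.chainLeft (y + 1) - 1 ≤ S.chainRight (y + 1) := by
      have hm := S.tiers_pos
      rw [chainLeft, chainRight, add_sub_cancel_right]
      rw [add_sub_cancel_right] at hL hR
      rcases eq_or_lt_of_le hy with rfl | hy
      · have := S.extLeft_add_two_le (y := 0) (by omega) (by omega)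
        simp at *
        omega
      · have := S.extLeft_add_two_le (y := y) (by omega) (by omega); omega
    -- At the right end no slanted bond leaves the chain, so the identity compares the totals of the
    -- two rows.
    have h := K.chain_identity (by omega) h1 hC le_rfl
    rw [horiz_chainRight, add_sub_cancel_right] at h
    rw [add_sub_cancel_right] at hL hR
    have e1 : K.vertCount (y + 1) (S.chainRight (y + 1)) = K.vertCount (y + 1) (S.extRight (y + 1)) :=
      K.vertCount_const (by rw [chainRight]; omega)
    have e2 : K.vertCount y (S.chainRight (y + 1)) = K.vertCount y (S.extRight y) :=
      K.vertCount_const (by rw [chainRight, add_sub_cancel_right]; omega)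
    rw [e1, e2, chainRight, add_sub_cancel_right] at h
    split_ifs at h <;> omega

theorem vertCount_eq_ord (k : Fin m) {x : ℤ} (hx : S.extRight k ≤ x) :
    K.vertCount k x = S.ord k := by
  rw [K.vertCount_const hx]
  have h := K.two_mul_vertCount (y := k) (by omega) (by omega)
  have := S.ord_eq k
  omega

theorem vertCount_le_ord (k : Fin m) (x : ℤ) : K.vertCount k x ≤ S.ord k := by
  rw [← K.vertCount_eq_ord k (le_max_left _ x)]
  exact K.vertCount_mono _ (le_max_right _ x)

theorem vertCount_nonneg (y x : ℤ) : 0 ≤ K.vertCount y x :=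
  Finset.sum_nonneg fun z _ => by rcases K.vert_eq_zero_or_one y z with h | h <;> omega

theorem ord_nonneg (K : S.Kekule) (k : Fin m) : 0 ≤ S.ord k := by
  rw [← K.vertCount_eq_ord k le_rfl]
  exact K.vertCount_nonneg _ _

/-- A Kekulé structure is determined by the numbers of its vertical double bonds. -/
theorem ext_of_vertCount {K K' : S.Kekule} (h : ∀ y x, K.vertCount y x = K'.vertCount y x) :
    K = K' := by
  have hv : ∀ y x, K.vert y x = K'.vert y x := by
    intro y x
    have h1 := K.vertCount_sub_one y x
    have h2 := K'.vertCount_sub_one y x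
    rw [h, h] at h1
    omega
  have hh : ∀ y x, K.horiz y x = K'.horiz y x := by
    intro y x
    by_cases hr : 0 ≤ y ∧ y ≤ m ∧ S.chainLeft y ≤ x ∧ x + 1 ≤ S.chainRight y
    · have h1 := K.chain_identity (x := x) hr.1 hr.2.1 (by omega) (by omega)
      have h2 := K'.chain_identity (x := x) hr.1 hr.2.1 (by omega) (by omega)
      rw [h, h] at h1
      split_ifs at h1 h2 <;> omega
    · have h1 := K.of_horiz_eq_one (y := y) (x := x)
      have h2 := K'.of_horiz_eq_one (y := y) (x := x)
      have z1 := K.horiz_eq_zero_or_one y x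
      have z2 := K'.horiz_eq_zero_or_one y x
      omega
  have hV : ∀ x y, K.toSubgraph.Adj (x, y) (x, y + 1) ↔ K'.toSubgraph.Adj (x, y) (x, y + 1) := by
    intro x y
    rw [← vert_eq_one, ← vert_eq_one, hv]
  have hH : ∀ x y, K.toSubgraph.Adj (x, y) (x + 1, y) ↔ K'.toSubgraph.Adj (x, y) (x + 1, y) := by
    intro x y
    rw [← horiz_eq_one, ← horiz_eq_one, hh]
  have key : K.toSubgraph = K'.toSubgraph := by
    refine SimpleGraph.Subgraph.ext (K.spanning.trans K'.spanning.symm) ?_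
    funext ⟨x, y⟩ ⟨x', y'⟩
    apply propext
    by_cases hadj : hexLattice.Adj (x, y) (x', y')
    · rw [hexLattice_adj] at hadj
      rcases hadj with ⟨rfl, rfl | rfl⟩ | ⟨rfl, ⟨rfl, -⟩ | ⟨rfl, -⟩⟩
      · exact hH _ _
      · rw [K.toSubgraph.adj_comm, K'.toSubgraph.adj_comm]; exact hH _ _
      · exact hV _ _
      · rw [K.toSubgraph.adj_comm, K'.toSubgraph.adj_comm]; exact hV _ _
    · exact ⟨fun h => absurd h.adj_sub hadj, fun h => absurd h.adj_sub hadj⟩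
  cases K
  cases K'
  simpa using key

end Kekule

end RegularStrip

/-! ### Kekulé structures from interlacing counts -/

namespace RegularStrip

variable {m n : ℕ} {S : RegularStrip m n}

/-- Converse of `vert_add_horiz`: indicators summing to 1 at a vertex choose exactly one of its
edges. -/
theorem exists_kekule_of_indicators (v e : ℤ → ℤ → ℤ) (hv01 : ∀ y x, v y x = 0 ∨ v y x = 1)
    (he01 : ∀ y x, e y x = 0 ∨ e y x = 1)
    (hv : ∀ y x, v y x = 1 →
      0 ≤ y ∧ y < m ∧ (x + y) % 2 = 0 ∧ S.extLeft y ≤ x ∧ x ≤ S.extRight y)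
    (he : ∀ y x, e y x = 1 → 0 ≤ y ∧ y ≤ m ∧ S.chainLeft y ≤ x ∧ x + 1 ≤ S.chainRight y)
    (hsum : ∀ y x : ℤ, 0 ≤ y → y ≤ m → S.chainLeft y ≤ x → x ≤ S.chainRight y →
      v y x + v (y - 1) x + e y x + e y (x - 1) = 1) :
    ∃ K : S.Kekule, ∀ y x, K.vert y x = v y x := by
  let R : ℤ × ℤ → ℤ × ℤ → Prop := fun u w =>
    (w.2 = u.2 ∧ w.1 = u.1 + 1 ∧ e u.2 u.1 = 1) ∨ (w.1 = u.1 ∧ w.2 = u.2 + 1 ∧ v u.2 u.1 = 1)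
  have hR : ∀ u w, R u w → S.graph.Adj u w := by
    rintro ⟨x, y⟩ ⟨x', y'⟩ (⟨h1, h2, h3⟩ | ⟨h1, h2, h3⟩) <;> simp only at h1 h2 h3 <;> subst h1 h2
    · exact (S.graph_adj_right _ _).2 (he _ _ h3)
    · exact (S.graph_adj_down _ _).2 (hv _ _ h3)
  have hadj : ∀ u w, R u w ∨ R w u → S.graph.Adj u w := by
    rintro u w (h | h)
    · exact hR _ _ h
    · exact (hR _ _ h).symm
  let G : hexLattice.Subgraph :=
    { verts := S.graph.verts
      Adj := fun u w => R u w ∨ R w u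
      adj_sub := fun h => (hadj _ _ h).adj_sub
      edge_vert := fun h => S.graph.edge_vert (hadj _ _ h)
      symm := ⟨fun _ _ h => h.symm⟩ }
  have hG : G.IsMatching := by
    rintro ⟨x, y⟩ hxy
    have hxy' := (S.mem_graph_verts x y).1 hxy
    have h := hsum y x hxy'.1 hxy'.2.1 hxy'.2.2.1 hxy'.2.2.2
    have z1 := hv01 y x
    have z2 := hv01 (y - 1) x
    have z3 := he01 y x
    have z4 := he01 y (x - 1)
    have key : ∀ x' y', G.Adj (x, y) (x', y') ↔
        (x' = x + 1 ∧ y' = y ∧ e y x = 1) ∨ (x' = x ∧ y' = y + 1 ∧ v y x = 1) ∨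
        (x' = x - 1 ∧ y' = y ∧ e y (x - 1) = 1) ∨ (x' = x ∧ y' = y - 1 ∧ v (y - 1) x = 1) := by
      intro x' y'
      constructor
      · rintro ((⟨h1, h2, h3⟩ | ⟨h1, h2, h3⟩) | (⟨h1, h2, h3⟩ | ⟨h1, h2, h3⟩)) <;>
          simp only at h1 h2 h3 <;> subst h1 h2
        · exact Or.inl ⟨rfl, rfl, h3⟩
        · exact Or.inr (Or.inl ⟨rfl, rfl, h3⟩)
        · refine Or.inr (Or.inr (Or.inl ⟨by ring, rfl, ?_⟩))
          rwa [add_sub_cancel_right]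
        · refine Or.inr (Or.inr (Or.inr ⟨rfl, by ring, ?_⟩))
          rwa [add_sub_cancel_right]
      · rintro (⟨rfl, rfl, h3⟩ | ⟨rfl, rfl, h3⟩ | ⟨rfl, rfl, h3⟩ | ⟨rfl, rfl, h3⟩)
        · exact Or.inl (Or.inl ⟨rfl, rfl, h3⟩)
        · exact Or.inl (Or.inr ⟨rfl, rfl, h3⟩)
        · exact Or.inr (Or.inl ⟨rfl, by simp, h3⟩)
        · exact Or.inr (Or.inr ⟨rfl, by simp, h3⟩)
    have hex : ∃ x' y', G.Adj (x, y) (x', y') := by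
      simp only [key]
      by_cases k1 : v y x = 1
      · exact ⟨x, y + 1, by omega⟩
      by_cases k2 : v (y - 1) x = 1
      · exact ⟨x, y - 1, by omega⟩
      by_cases k3 : e y x = 1
      · exact ⟨x + 1, y, by omega⟩
      · exact ⟨x - 1, y, by omega⟩
    obtain ⟨x', y', h'⟩ := hex
    refine ⟨(x', y'), h', ?_⟩
    rintro ⟨x'', y''⟩ h''
    rw [key] at h'
    have h'' := (key _ _).1 h''
    rw [Prod.mk.injEq]
    omega
  refine ⟨⟨G, ⟨le_rfl, fun u w h => hadj u w h⟩, rfl, hG⟩, fun y x => ?_⟩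
  have hiff : G.Adj (x, y) (x, y + 1) ↔ v y x = 1 := by
    constructor
    · rintro ((⟨h1, h2, h3⟩ | ⟨h1, h2, h3⟩) | (⟨h1, h2, h3⟩ | ⟨h1, h2, h3⟩)) <;>
        simp only at h1 h2 h3 <;> omega
    · exact fun h => Or.inl (Or.inr ⟨rfl, rfl, h⟩)
  by_cases h : v y x = 1
  · rw [h, Kekule.vert_eq_one]
    exact hiff.2 h
  · have h0 := (hv01 y x).resolve_right h
    rw [h0, Kekule.vert, if_neg]
    exact fun h' => h (hiff.1 h')

/-- Families of counting functions with the necessary interlacing properties come from Kekulé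
structures. -/
theorem exists_kekule_of_counts (N : ℤ → ℤ → ℤ) (hzero : ∀ y x, x < S.extLeft y → N y x = 0)
    (hrow : ∀ y : ℤ, (y < 0 ∨ m ≤ y) → ∀ x, N y x = 0)
    (hstep : ∀ y x, N y x = N y (x - 1) ∨ (N y x = N y (x - 1) + 1 ∧ (x + y) % 2 = 0 ∧
      S.extLeft y ≤ x ∧ x ≤ S.extRight y))
    (hint : ∀ y : ℤ, 0 ≤ y → y ≤ m → ∀ x,
      (S.extLeft y < S.extLeft (y - 1) → N (y - 1) x ≤ N y x ∧ N y x ≤ N (y - 1) x + 1) ∧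
      (S.extLeft (y - 1) < S.extLeft y → N y x ≤ N (y - 1) x ∧ N (y - 1) x ≤ N y x + 1))
    (htot : ∀ y : ℤ, -1 ≤ y → y ≤ m → ∀ x, S.extRight y ≤ x →
      2 * N y x = S.extRight y - S.extLeft y + 2 - 2 * n) :
    ∃ K : S.Kekule, ∀ y x, K.vertCount y x = N y x := by
  -- This is `chain_identity` solved for the slanted indicator; `e` cuts it off outside the chain.
  let f : ℤ → ℤ → ℤ := fun y x =>
    if (x + y) % 2 = 0 then (if S.extLeft y < S.extLeft (y - 1) then 1 else 0) - N y x + N (y - 1) x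
    else (if S.extLeft (y - 1) < S.extLeft y then 1 else 0) - N (y - 1) x + N y x
  let e : ℤ → ℤ → ℤ := fun y x =>
    if 0 ≤ y ∧ y ≤ m ∧ S.chainLeft y ≤ x ∧ x + 1 ≤ S.chainRight y then f y x else 0
  have hf01 : ∀ y : ℤ, 0 ≤ y → y ≤ m → ∀ x, f y x = 0 ∨ f y x = 1 := by
    intro y h0 h1 x
    have h2 := S.extLeft_step h0 h1
    have h3 := hint y h0 h1 x
    simp only [f]
    split_ifs <;> omega
  have hf_left : ∀ y : ℤ, 0 ≤ y → y ≤ m → f y (S.chainLeft y - 1) = 0 := by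
    intro y h0 h1
    have h2 := S.extLeft_step h0 h1
    have h3 := S.extLeft_parity (y := y) (by omega) h1
    simp only [f, chainLeft]
    rw [hzero _ _ (by omega), hzero _ _ (by omega)]
    split_ifs <;> omega
  have hf_right : ∀ y : ℤ, 0 ≤ y → y ≤ m → f y (S.chainRight y) = 0 := by
    intro y h0 h1
    have h2 := S.extLeft_step h0 h1
    have h3 := S.extRight_step h0 h1
    have h4 := S.extRight_parity (y := y) (by omega) h1
    have h5 := htot y (by omega) h1 (S.chainRight y) (by rw [chainRight]; omega)
    have h6 := htot (y - 1) (by omega) (by omega) (S.chainRight y) (by rw [chainRight]; omega)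
    simp only [f, chainRight] at *
    split_ifs <;> omega
  -- `f` vanishes at both ends, on the right because of the prescribed totals, so the cut-off
  -- changes nothing and the vertex sums telescope.
  have hef : ∀ y x : ℤ, 0 ≤ y → y ≤ m → S.chainLeft y - 1 ≤ x → x ≤ S.chainRight y →
      e y x = f y x := by
    intro y x h0 h1 h2 h3
    simp only [e]
    split_ifs with h
    · rfl
    · have : x = S.chainLeft y - 1 ∨ x = S.chainRight y := by omega
      rcases this with rfl | rfl
      · exact (hf_left y h0 h1).symm
      · exact (hf_right y h0 h1).symm
  obtain ⟨K, hK⟩ := exists_kekule_of_indicators (S := S) (fun y x => N y x - N y (x - 1)) e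
    (by intro y x; have := hstep y x; omega)
    (by
      intro y x
      by_cases h : 0 ≤ y ∧ y ≤ m ∧ S.chainLeft y ≤ x ∧ x + 1 ≤ S.chainRight y
      · simp only [e, if_pos h]; exact hf01 y h.1 h.2.1 x
      · simp only [e, if_neg h]; simp)
    (by
      intro y x h
      have h1 := hstep y x
      have h2 : ¬ (y < 0 ∨ m ≤ y) := by
        intro h2
        rw [hrow y h2, hrow y h2] at h
        omega
      omega)
    (by
      intro y x h
      by_contra h'
      simp only [e, if_neg h'] at h
      omega)
    (by
      intro y x h0 h1 h2 h3
      rw [hef y x h0 h1 (by omega) h3, hef y (x - 1) h0 h1 (by omega) (by omega)]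
      have h4 := hstep y x
      have h5 := hstep (y - 1) x
      have h6 := S.extLeft_step h0 h1
      simp only [f]
      split_ifs <;> omega)
  refine ⟨K, fun y x => ?_⟩
  rcases lt_or_ge x (S.extLeft y - 1) with h | h
  · rw [K.vertCount_eq_zero (by omega), hzero _ _ (by omega)]
  · induction x, h using Int.leInduction with
    | base => rw [K.vertCount_eq_zero (by omega), hzero _ _ (by omega)]
    | succ x hx ih =>
      rw [K.vertCount_sub_one, hK, add_sub_cancel_right, ih]
      ring

end RegularStrip

/-! ### Positions and shifts of dibs -/

namespace RegularStrip

variable {m n : ℕ} {S : RegularStrip m n}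

namespace Kekule

variable (K : S.Kekule)

/-- The bounds on `p` are automatic, since a vertical double bond lies in the strip. -/
theorem isDoubleAt_iff (k : Fin m) (p : ℕ) :
    K.IsDoubleAt k p ↔ K.vert k (S.left k + 2 * ((p : ℤ) - 1)) = 1 := by
  have h : S.interfaceBond k p ∈ K.toSubgraph.edgeSet ↔
      K.vert k (S.left k + 2 * ((p : ℤ) - 1)) = 1 := by
    rw [vert_eq_one, interfaceBond, verticalEdge, SimpleGraph.Subgraph.mem_edgeSet]
  rw [IsDoubleAt, h]
  refine ⟨fun h => h.2.2, fun h => ?_⟩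
  have h1 := K.of_vert_eq_one h
  rw [extLeft_coe, extRight_coe] at h1
  rw [interfaceCard]
  omega

-- `Nat.count` at `p + 1` counts the indices 0,…,p, and index 0 is never a bond. Consecutive bonds
-- are two positions apart.
open Classical in
theorem count_isDoubleAt (k : Fin m) (p : ℕ) :
    (Nat.count (K.IsDoubleAt k) (p + 1) : ℤ) = K.vertCount k (S.left k + 2 * ((p : ℤ) - 1)) := by
  induction p with
  | zero =>
    have : ¬ K.IsDoubleAt k 0 := fun h => absurd h.1 (by norm_num)
    rw [K.vertCount_eq_zero (by rw [extLeft_coe]; push_cast; omega)]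
    simp [Nat.count_succ, this]
  | succ p ih =>
    rw [Nat.count_succ]
    have h1 := K.vertCount_sub_one k (S.left k + 2 * (((p + 1 : ℕ) : ℤ) - 1))
    have h2 := K.vertCount_sub_one k (S.left k + 2 * (((p + 1 : ℕ) : ℤ) - 1) - 1)
    have h3 : K.vert k (S.left k + 2 * (((p + 1 : ℕ) : ℤ) - 1) - 1) = 0 := by
      rcases K.vert_eq_zero_or_one k (S.left k + 2 * (((p + 1 : ℕ) : ℤ) - 1) - 1) with h | h
      · exact h
      · have h4 := K.of_vert_eq_one h
        have h5 := S.extLeft_parity (y := k) (by omega) (by omega)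
        rw [extLeft_coe] at h5
        omega
    have h4 : S.left k + 2 * (((p + 1 : ℕ) : ℤ) - 1) - 1 - 1 = S.left k + 2 * ((p : ℤ) - 1) := by
      push_cast; ring
    rw [h4] at h2
    have h5 := K.vert_eq_zero_or_one k (S.left k + 2 * (((p + 1 : ℕ) : ℤ) - 1))
    have h6 := K.isDoubleAt_iff k (p + 1)
    split_ifs with h
    · have := h6.1 h
      push_cast [ih] at *
      omega
    · have := mt h6.2 h
      push_cast [ih] at *
      omega

theorem pos_eq_of_vertCount (s : S.Dib) (p : ℕ)
    (h1 : K.vert s.k (S.left s.k + 2 * ((p : ℤ) - 1)) = 1)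
    (h2 : K.vertCount s.k (S.left s.k + 2 * ((p : ℤ) - 1)) = s.j) : K.pos s = p := by
  classical
  rw [← isDoubleAt_iff] at h1
  rw [← count_isDoubleAt, Nat.count_succ, if_pos h1] at h2
  have h3 : Nat.count (K.IsDoubleAt s.k) p = s.j - 1 := by omega
  rw [pos, ← h3, Nat.nth_count h1]

/-- The row contains `ord` double bonds and `j ≤ ord`, so the `j`-th one exists and `Nat.nth` does
not fall back on its default value. -/
theorem pos_spec (s : S.Dib) : K.vert s.k (S.left s.k + 2 * ((K.pos s : ℤ) - 1)) = 1 ∧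
    K.vertCount s.k (S.left s.k + 2 * ((K.pos s : ℤ) - 1)) = s.j := by
  classical
  have hex : ∃ p, s.j ≤ Nat.count (K.IsDoubleAt s.k) (p + 1) := by
    refine ⟨S.interfaceCard s.k, ?_⟩
    have h := K.count_isDoubleAt s.k (S.interfaceCard s.k)
    rw [K.vertCount_eq_ord s.k (by rw [extRight_coe, interfaceCard]; push_cast; omega)] at h
    have := s.le_ord
    omega
  have h1 := Nat.find_spec hex
  have h2 : Nat.count (K.IsDoubleAt s.k) (Nat.find hex) < s.j := by
    rcases h : Nat.find hex with _ | q
    · have := s.one_le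
      simp only [Nat.count_zero]; omega
    · exact not_le.1 (Nat.find_min hex (m := q) (by omega))
  have h3 := K.count_isDoubleAt s.k (Nat.find hex)
  have h4 : K.IsDoubleAt s.k (Nat.find hex) := by
    by_contra h
    rw [Nat.count_succ, if_neg h] at h1
    omega
  have h5 : K.vertCount s.k (S.left s.k + 2 * ((Nat.find hex : ℤ) - 1)) = s.j := by
    rw [Nat.count_succ, if_pos h4] at h1 h3
    omega
  have h6 := (K.isDoubleAt_iff _ _).1 h4
  rw [K.pos_eq_of_vertCount s _ h6 h5]
  exact ⟨h6, h5⟩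

/-- The horizontal position of the bond of `K` corresponding to a dib. -/
noncomputable def dibX (s : S.Dib) : ℤ := S.left s.k + 2 * ((K.pos s : ℤ) - 1)

/-- Counts and positions are adjoint to each other; this translates interlacing into inequalities
between positions and back. -/
theorem le_vertCount_iff (s : S.Dib) (x : ℤ) : (s.j : ℤ) ≤ K.vertCount s.k x ↔ K.dibX s ≤ x := by
  have h := K.pos_spec s
  rw [← dibX] at h
  have h1 := K.vertCount_sub_one s.k (K.dibX s)
  constructor
  · intro hx
    by_contra hlt
    have := K.vertCount_mono s.k (show x ≤ K.dibX s - 1 by omega)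
    omega
  · intro hx
    have := K.vertCount_mono s.k hx
    omega

theorem le_pos (s : S.Dib) : s.j ≤ K.pos s := by
  classical
  have h := (K.pos_spec s).2
  rw [← count_isDoubleAt] at h
  have : ¬ K.IsDoubleAt s.k 0 := fun h => absurd h.1 (by norm_num)
  have h1 : Nat.count (K.IsDoubleAt s.k) 1 = 0 := by simp [Nat.count_succ, this]
  rw [add_comm, Nat.count_add, h1] at h
  have := Nat.count_le (p := fun k => K.IsDoubleAt s.k (1 + k)) (n := K.pos s)
  omega

theorem pos_le_interfaceCard (s : S.Dib) : K.pos s ≤ S.interfaceCard s.k :=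
  ((K.isDoubleAt_iff _ _).2 (K.pos_spec s).1).2.1

/-- The remaining `ord - j` double bonds must fit among the `interfaceCard - pos` bonds to the
right, and `interfaceCard - ord = n`. -/
theorem pos_le (s : S.Dib) : K.pos s ≤ n + s.j := by
  classical
  have h := (K.pos_spec s).2
  have h1 := K.pos_le_interfaceCard s
  have h2 := K.count_isDoubleAt s.k (S.interfaceCard s.k)
  rw [K.vertCount_eq_ord s.k (by rw [extRight_coe, interfaceCard]; push_cast; omega)] at h2
  rw [← count_isDoubleAt] at h
  rw [show S.interfaceCard s.k + 1 = (K.pos s + 1) + (S.interfaceCard s.k - K.pos s) by omega,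
    Nat.count_add, ord] at h2
  have := Nat.count_le (p := fun k => K.IsDoubleAt s.k (K.pos s + 1 + k))
    (n := S.interfaceCard s.k - K.pos s)
  omega

/-- The number of steps by which the bond corresponding to a dib is shifted from its leftmost
possible position. -/
noncomputable def shift (s : S.Dib) : ℕ := K.pos s - s.j

theorem pos_eq_shift_add (s : S.Dib) : K.pos s = K.shift s + s.j := by
  have := K.le_pos s
  rw [shift]; omega

theorem shift_le (s : S.Dib) : K.shift s ≤ n := by
  have := K.pos_le s
  rw [shift]; omega

/-- The difference is odd, so the bond of `s` is to the left of that of `t` iff `shift s ≤ shift t`.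
-/
theorem dibX_sub_of_cover {s t : S.Dib} (h : s.Cover t) :
    K.dibX t - K.dibX s = 2 * ((K.shift t : ℤ) - K.shift s) + 1 := by
  have := h.rank
  rw [dibX, dibX, pos_eq_shift_add, pos_eq_shift_add]
  push_cast
  omega

end Kekule

/-! ### Neighbouring dibs in adjacent rows -/

theorem Dib.Cover.index_eq {s t : S.Dib} (h : t.Cover s) :
    (t.j : ℤ) = s.j - if S.extLeft s.k < S.extLeft t.k then 1 else 0 := by
  rw [extLeft_coe, extLeft_coe]
  rcases h.2 with h | h <;> split_ifs <;> omega

/-- A dib covers a dib in each adjacent row unless the index of the latter would be `0`. -/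
theorem Dib.exists_cover (K : S.Kekule) (s : S.Dib) {y : ℤ} (hy : y = s.k + 1 ∨ (s.k : ℤ) = y + 1)
    (hj : (1 : ℤ) ≤ s.j - if S.extLeft s.k < S.extLeft y then 1 else 0) :
    ∃ t : S.Dib, (t.k : ℤ) = y ∧ t.Cover s := by
  have hs := s.k.2
  have hstep : S.extLeft s.k = S.extLeft y + 1 ∨ S.extLeft s.k = S.extLeft y - 1 := by
    rcases hy with rfl | hy
    · have := S.extLeft_step (y := s.k + 1) (by omega) (by omega)
      rw [add_sub_cancel_right] at this
      omega
    · have := S.extLeft_step (y := s.k) (by omega) (by omega)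
      rwa [show (s.k : ℤ) - 1 = y by omega] at this
  -- Far to the right the counts are the totals, so interlacing bounds the order of row `y` from
  -- below. For a virtual row the total is 0, which contradicts `hj`.
  have h1 : (s.j : ℤ) - (if S.extLeft s.k < S.extLeft y then 1 else 0) ≤
      K.vertCount y (max (S.extRight s.k) (S.extRight y)) := by
    have h2 := K.vertCount_eq_ord s.k (le_max_left (S.extRight s.k) (S.extRight y))
    have h3 := s.le_ord
    split_ifs with h
    · have := K.interlace hy (by omega) (by omega) h (max (S.extRight s.k) (S.extRight y))
      omega
    · have := K.interlace hy.symm (by omega) (by omega) (by omega)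
        (max (S.extRight s.k) (S.extRight y))
      omega
  by_cases hr : y < 0 ∨ m ≤ y
  · rw [K.vertCount_of_row hr] at h1
    omega
  · obtain ⟨k, rfl⟩ := exists_row (m := m) (y := y) (by omega) (by omega)
    rw [K.vertCount_eq_ord k (le_max_right _ _)] at h1
    refine ⟨⟨k, (s.j - if S.extLeft s.k < S.extLeft k then 1 else 0), ?_, ?_⟩, rfl, ?_, ?_⟩
    · split_ifs at hj ⊢ <;> omega
    · split_ifs at h1 ⊢ <;> omega
    · simp only; rw [abs_eq (by norm_num)]; omega
    · simp only [← extLeft_coe]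
      split_ifs at hj ⊢ <;> omega

/-- Going down in the order through the row above and back lowers the index by exactly one. The top
row has order 1, so index 2 forces a row above. Consecutive dibs of a row are therefore comparable.
-/
theorem Dib.exists_lt_same_row (K : S.Kekule) (s : S.Dib) (hj : 2 ≤ s.j) :
    ∃ r t : S.Dib, r.k = s.k ∧ r.j + 1 = s.j ∧ r.Cover t ∧ t.Cover s := by
  obtain ⟨t, ht, hts⟩ := s.exists_cover K (y := s.k - 1) (by omega) (by split_ifs <;> omega)
  have h1 := hts.index_eq
  have hs := s.k.2
  have hstep := S.extLeft_step (y := s.k) (by omega) (by omega)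
  rw [← ht] at hstep
  obtain ⟨r, hr, hrt⟩ := t.exists_cover K (y := s.k) (by omega) (by split_ifs at h1 ⊢ <;> omega)
  have h2 := hrt.index_eq
  refine ⟨r, t, Fin.ext (by omega), ?_, hrt, hts⟩
  rw [hr] at h2
  split_ifs at h1 h2 <;> omega

/-! ### Monotonicity of shifts and proper sextets -/

namespace Kekule

variable (K : S.Kekule)

theorem shift_le_of_cover {s t : S.Dib} (h : s.Cover t) : K.shift s ≤ K.shift t := by
  have h1 := K.dibX_sub_of_cover h
  have h2 : K.dibX s ≤ K.dibX t := by
    rw [← le_vertCount_iff]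
    have h3 := (K.le_vertCount_iff t (K.dibX t)).2 le_rfl
    have h4 := h.index_eq
    have hadj : (s.k : ℤ) = t.k + 1 ∨ (t.k : ℤ) = s.k + 1 := by
      have := (abs_eq (by norm_num)).1 h.1
      omega
    have hs := s.k.2
    have ht := t.k.2
    rcases h.2 with h5 | h5 <;> rw [← extLeft_coe, ← extLeft_coe] at h5
    · have := K.interlace hadj.symm (by omega) (by omega) h5.1 (K.dibX t)
      omega
    · have := K.interlace hadj (by omega) (by omega) h5.1 (K.dibX t)
      omega
  omega

theorem shift_mono : Monotone K.shift := by
  rintro s t (h : Relation.ReflTransGen Dib.Cover s t)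
  induction h with
  | refl => exact le_rfl
  | tail _ h ih => exact ih.trans (K.shift_le_of_cover h)

theorem ext_of_pos {K K' : S.Kekule} (h : ∀ s, K.pos s = K'.pos s) : K = K' := by
  refine ext_of_vertCount fun y x => ?_
  by_cases hr : y < 0 ∨ m ≤ y
  · rw [vertCount_of_row _ hr, vertCount_of_row _ hr]
  obtain ⟨k, rfl⟩ := exists_row (m := m) (y := y) (by omega) (by omega)
  have key : ∀ K K' : S.Kekule, (∀ s, K.pos s = K'.pos s) →
      K.vertCount k x ≤ K'.vertCount k x := by
    intro K K' h
    have h0 := K.vertCount_nonneg k x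
    have h0' := K'.vertCount_nonneg k x
    by_cases h1 : K.vertCount k x ≤ 0
    · omega
    have h2 := K.vertCount_le_ord k x
    have h3 := K.le_vertCount_iff ⟨k, (K.vertCount k x).toNat, by omega, by omega⟩ x
    have h4 := K'.le_vertCount_iff ⟨k, (K.vertCount k x).toNat, by omega, by omega⟩ x
    rw [dibX, h, ← dibX, ← h4] at h3
    simp only at h3
    omega
  exact le_antisymm (key _ _ h) (key _ _ fun s => (h s).symm)

/-- Only the right edge of the sextet is vertical, so the bond of `s` must be that edge and the
hexagon starts at `dibX s - 2`. -/
theorem mem_properDibs_iff_horiz (s : S.Dib) : s ∈ K.properDibs ↔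
    2 ≤ K.pos s ∧ K.horiz s.k (K.dibX s - 2) = 1 ∧ K.horiz (s.k + 1) (K.dibX s - 2) = 1 := by
  rw [horiz_eq_one, horiz_eq_one]
  constructor
  · rintro ⟨k, i, hsub, hmem⟩
    have hx : S.left s.k + 2 * ((K.pos s : ℤ) - 1) = S.left k + 2 * (i : ℤ) + 2 ∧
        (s.k : ℤ) = k := by
      simp only [bond, sextetEdges, interfaceBond, verticalEdge, Set.mem_insert_iff,
        Set.mem_singleton_iff, Sym2.eq_iff, Prod.mk.injEq] at hmem
      omega
    have hk : s.k = k := Fin.ext (by omega)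
    subst hk
    have hX : K.dibX s - 2 = S.left s.k + 2 * (i : ℤ) := by rw [dibX]; omega
    rw [hX]
    refine ⟨by omega, ?_, ?_⟩
    · exact SimpleGraph.Subgraph.mem_edgeSet.1 (hsub (by simp [sextetEdges]))
    · exact SimpleGraph.Subgraph.mem_edgeSet.1 (hsub (by simp [sextetEdges]))
  · rintro ⟨hp, h1, h2⟩
    have hc := K.pos_le_interfaceCard s
    rw [interfaceCard] at hc
    have hX : S.left s.k + 2 * ((K.pos s - 2 : ℕ) : ℤ) = K.dibX s - 2 := by rw [dibX]; omega
    refine ⟨s.k, ⟨K.pos s - 2, by omega⟩, ?_, ?_⟩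
    · simp only [hX]
      rintro e (rfl | rfl | rfl)
      · rw [sub_add_cancel]
        exact SimpleGraph.Subgraph.mem_edgeSet.2 (K.vert_eq_one.1 (K.pos_spec s).1)
      · exact SimpleGraph.Subgraph.mem_edgeSet.2 h1
      · exact SimpleGraph.Subgraph.mem_edgeSet.2 h2
    · simp only [hX]
      left
      rw [sub_add_cancel]
      rfl

/-- Row `s.k` has `s.j - 1` double bonds up to `dibX s - 2`. By the chain identity the slanted bond
is double iff the count of row `y` there reaches the index of the lower neighbour `t`, i.e. iff `t`
sits at least two positions to the left of `s`, which means a smaller shift. If that index would be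
0, the bond is always double. -/
theorem horiz_eq_one_iff_cover (s : S.Dib) (hp : 2 ≤ K.pos s) {y : ℤ}
    (hy : y = s.k + 1 ∨ (s.k : ℤ) = y + 1) : K.horiz (max (s.k : ℤ) y) (K.dibX s - 2) = 1 ↔
      ∀ t : S.Dib, (t.k : ℤ) = y → t.Cover s → K.shift t < K.shift s := by
  have hs := s.k.2
  have hspec := K.pos_spec s
  have hv := K.of_vert_eq_one hspec.1
  rw [← dibX] at hspec hv
  have hX : S.extLeft s.k ≤ K.dibX s - 2 := by rw [dibX, extLeft_coe]; omega
  have hcL : S.chainLeft (max (s.k : ℤ) y) ≤ S.extLeft s.k := by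
    rw [chainLeft]
    rcases hy with rfl | hy
    · rw [max_eq_right (by omega), add_sub_cancel_right]; exact min_le_left _ _
    · rw [max_eq_left (by omega)]; exact min_le_right _ _
  have hcR : S.extRight s.k ≤ S.chainRight (max (s.k : ℤ) y) := by
    rw [chainRight]
    rcases hy with rfl | hy
    · rw [max_eq_right (by omega : (s.k : ℤ) ≤ s.k + 1), add_sub_cancel_right]
      exact le_max_left _ _
    · rw [max_eq_left (by omega : y ≤ (s.k : ℤ))]; exact le_max_right _ _
  have he := K.horiz_eq (x := K.dibX s - 2) hy (by omega) (by omega) (by omega) (by omega)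
    (by omega)
  have h1 := K.vertCount_sub_one s.k (K.dibX s)
  have h2 := K.vertCount_sub_one s.k (K.dibX s - 1)
  have h3 : K.vert s.k (K.dibX s - 1) = 0 := by
    rcases K.vert_eq_zero_or_one s.k (K.dibX s - 1) with h | h
    · exact h
    · have := K.of_vert_eq_one h
      omega
  rw [show K.dibX s - 1 - 1 = K.dibX s - 2 by ring] at h2
  have h01 := K.horiz_eq_zero_or_one (max (s.k : ℤ) y) (K.dibX s - 2)
  constructor
  · rintro h t rfl hts
    have hj := hts.index_eq
    have h4 := (K.le_vertCount_iff t (K.dibX s - 2)).1 (by omega)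
    have h5 := K.dibX_sub_of_cover hts
    omega
  · intro h
    have h6 := K.vertCount_nonneg y (K.dibX s - 2)
    by_cases hj : (1 : ℤ) ≤ s.j - if S.extLeft s.k < S.extLeft y then 1 else 0
    · obtain ⟨t, rfl, hts⟩ := s.exists_cover K hy hj
      have h7 := h t rfl hts
      have hj := hts.index_eq
      have h5 := K.dibX_sub_of_cover hts
      have h4 := (K.le_vertCount_iff t (K.dibX s - 2)).2 (by omega)
      omega
    · omega

/-- The dibs in proper sextets are those which cannot be shifted to the left on their own. -/
theorem mem_properDibs_iff (s : S.Dib) : s ∈ K.properDibs ↔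
    0 < K.shift s ∧ ∀ t : S.Dib, t.Cover s → K.shift t < K.shift s := by
  have hsj := s.one_le
  have hpos := K.pos_eq_shift_add s
  have hsplit : 2 ≤ K.pos s → (s ∈ K.properDibs ↔
      ∀ t : S.Dib, t.Cover s → K.shift t < K.shift s) := by
    intro hp
    have h1 := K.horiz_eq_one_iff_cover s hp (y := s.k - 1) (by omega)
    have h2 := K.horiz_eq_one_iff_cover s hp (y := s.k + 1) (by omega)
    rw [max_eq_left (by omega)] at h1
    rw [max_eq_right (by omega)] at h2
    rw [mem_properDibs_iff_horiz, h1, h2]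
    constructor
    · rintro ⟨-, h3, h4⟩ t ht
      have := (abs_eq (by norm_num)).1 ht.1
      by_cases h : (t.k : ℤ) = s.k + 1
      · exact h4 t h ht
      · exact h3 t (by omega) ht
    · exact fun h => ⟨hp, fun t _ => h t, fun t _ => h t⟩
  constructor
  · intro h
    have hp := ((K.mem_properDibs_iff_horiz s).1 h).1
    have h1 := (hsplit hp).1 h
    refine ⟨?_, h1⟩
    -- For index 1, position at least 2 is a positive shift; for a larger index some dib lies below
    -- `s` and has a smaller shift.
    by_cases hj : s.j = 1
    · omega
    · obtain ⟨r, t, -, -, -, hts⟩ := s.exists_lt_same_row K (by omega)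
      have := h1 t hts
      omega
  · rintro ⟨h1, h2⟩
    exact (hsplit (by omega)).2 h2

end Kekule

/-! ### Kekulé structures from order-preserving shifts -/

theorem exists_nat_forall_le_iff {D : Set ℕ} (hb : BddAbove D)
    (hD : ∀ j, 1 ≤ j → j + 1 ∈ D → j ∈ D) : ∃ N : ℕ, ∀ j, 1 ≤ j → (j ≤ N ↔ j ∈ D) := by
  obtain ⟨B, hB⟩ := hb
  have hdown : ∀ d j, 1 ≤ j → j + d ∈ D → j ∈ D := by
    intro d
    induction d with
    | zero => exact fun j _ h => h
    | succ d ih => exact fun j hj h => ih j hj (hD (j + d) (by omega) h)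
  rcases D.eq_empty_or_nonempty with rfl | hne
  · exact ⟨0, fun j hj => by simp; omega⟩
  · refine ⟨sSup D, fun j hj => ⟨fun h => ?_, fun h => le_csSup ⟨B, hB⟩ h⟩⟩
    have hm := Nat.sSup_mem hne ⟨B, hB⟩
    exact hdown (sSup D - j) j hj (by rwa [Nat.add_sub_cancel' h])

/-- Every order-preserving assignment of shifts comes from a Kekulé structure. -/
theorem exists_kekule_of_shift (K₀ : S.Kekule) (h : S.Dib → ℕ) (hn : ∀ s, h s ≤ n)
    (hmono : ∀ s t : S.Dib, s.Cover t → h s ≤ h t) :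
    ∃ K : S.Kekule, ∀ s, K.pos s = h s + s.j := by
  let X : S.Dib → ℤ := fun s => S.left s.k + 2 * ((h s : ℤ) + s.j - 1)
  have hX : ∀ s t : S.Dib, s.Cover t → X s < X t := by
    intro s t hst
    have h1 := hst.rank
    have h2 := hmono s t hst
    simp only [X]
    omega
  have hXL : ∀ s, S.extLeft s.k ≤ X s := by
    intro s
    have := s.one_le
    simp only [X, extLeft_coe]
    omega
  have hXR : ∀ s, X s ≤ S.extRight s.k := by
    intro s
    have h1 := s.le_ord
    have h2 := hn s
    rw [ord, interfaceCard] at h1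
    simp only [X, extRight_coe]
    omega
  have hXp : ∀ s, (X s + s.k) % 2 = 0 := by
    intro s
    have h1 := s.k.2
    have h2 := S.extLeft_parity (y := s.k) (by omega) (by omega)
    rw [extLeft_coe] at h2
    simp only [X]
    omega
  -- The count to be realised: placements `X` increase along a row, so the indices of the dibs
  -- placed at or left of `x` form an initial segment.
  have hex : ∀ y x : ℤ, ∃ N : ℕ, ∀ j, 1 ≤ j →
      (j ≤ N ↔ j ∈ {j | ∃ s : S.Dib, (s.k : ℤ) = y ∧ s.j = j ∧ X s ≤ x}) := by
    intro y x
    refine exists_nat_forall_le_iff ?_ ?_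
    · by_cases hr : y < 0 ∨ m ≤ y
      · refine ⟨0, ?_⟩
        rintro j ⟨s, hs, -⟩
        have := s.k.2
        omega
      · obtain ⟨k, rfl⟩ := exists_row (m := m) (y := y) (by omega) (by omega)
        refine ⟨(S.ord k).toNat, ?_⟩
        rintro j ⟨s, hs, rfl, -⟩
        have h1 := s.le_ord
        rw [show s.k = k from Fin.ext (by omega)] at h1
        omega
    · rintro j hj ⟨s, hs, hsj, hsx⟩
      obtain ⟨r, t, hr, hrj, hrt, hts⟩ := s.exists_lt_same_row K₀ (by omega)
      exact ⟨r, by rw [hr]; exact hs, by omega,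
        ((hX _ _ hrt).trans (hX _ _ hts)).le.trans hsx⟩
  choose N hN using hex
  -- A dib placed at or left of `x` has a lower neighbour in the other row, placed further left; the
  -- index shift of `Dib.Cover` gives the two inequalities.
  have hinter : ∀ y y' : ℤ, (y' = y + 1 ∨ y = y' + 1) → S.extLeft y < S.extLeft y' → ∀ x,
      N y' x ≤ N y x ∧ N y x ≤ N y' x + 1 := by
    intro y y' hy hL x
    constructor
    · by_cases h0 : N y' x = 0
      · omega
      · obtain ⟨t, rfl, htj, htx⟩ := (hN y' x _ (by omega)).1 le_rfl
        have hj : (1 : ℤ) ≤ t.j - if S.extLeft t.k < S.extLeft y then 1 else 0 := by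
          rw [if_neg (by omega)]; omega
        obtain ⟨s, rfl, hst⟩ := t.exists_cover K₀ hy.symm hj
        have h1 := hst.index_eq
        rw [if_neg (by omega)] at h1
        rw [← htj]
        exact (hN _ x _ t.one_le).2 ⟨s, rfl, by omega, (hX _ _ hst).le.trans htx⟩
    · by_cases h0 : N y x ≤ 1
      · omega
      · obtain ⟨t, rfl, htj, htx⟩ := (hN y x _ (by omega)).1 le_rfl
        have hj : (1 : ℤ) ≤ t.j - if S.extLeft t.k < S.extLeft y' then 1 else 0 := by
          rw [if_pos hL]; omega
        obtain ⟨s, rfl, hst⟩ := t.exists_cover K₀ hy hj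
        have h1 := hst.index_eq
        rw [if_pos hL] at h1
        have := (hN _ x s.j s.one_le).2 ⟨s, rfl, rfl, (hX _ _ hst).le.trans htx⟩
        omega
  obtain ⟨K, hK⟩ := exists_kekule_of_counts (S := S) (fun y x => (N y x : ℤ))
    (by
      intro y x hx
      by_contra h0
      obtain ⟨s, rfl, -, hsx⟩ := (hN y x _ (by omega)).1 le_rfl
      have := hXL s
      omega)
    (by
      intro y hy x
      by_contra h0
      obtain ⟨s, rfl, -, -⟩ := (hN y x _ (by omega)).1 le_rfl
      have := s.k.2
      omega)
    (by
      intro y x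
      have h1 : N y (x - 1) ≤ N y x := by
        by_cases h0 : N y (x - 1) = 0
        · omega
        · obtain ⟨s, hs, hsj, hsx⟩ := (hN y (x - 1) _ (by omega)).1 le_rfl
          exact (hN y x _ (by omega)).2 ⟨s, hs, hsj, by omega⟩
      by_cases h2 : N y x = N y (x - 1)
      · left; rw [h2]
      · right
        obtain ⟨s, rfl, hsj, hsx⟩ := (hN y x _ (by omega)).1 le_rfl
        have h3 : ¬ X s ≤ x - 1 := by
          intro h3
          have := (hN _ (x - 1) s.j s.one_le).2 ⟨s, rfl, rfl, h3⟩
          omega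
        have hxs : x = X s := by omega
        have h4 : N s.k x ≤ N s.k (x - 1) + 1 := by
          by_cases h0 : N s.k x ≤ 1
          · omega
          · obtain ⟨r, t, hr, hrj, hrt, hts⟩ := s.exists_lt_same_row K₀ (by omega)
            have h5 := hX _ _ hrt
            have h6 := hX _ _ hts
            have := (hN s.k (x - 1) r.j r.one_le).2 ⟨r, by rw [hr], rfl, by omega⟩
            omega
        have h7 := hXL s
        have h8 := hXR s
        have h9 := hXp s
        rw [← hxs] at h7 h8 h9
        omega)
    (by
      intro y h0 h1 x
      have h2 := hinter y (y - 1) (by omega)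
      have h3 := hinter (y - 1) y (by omega)
      refine ⟨fun hL => ?_, fun hL => ?_⟩
      · have := h2 hL x; omega
      · have := h3 hL x; omega)
    (by
      intro y h0 h1 x hx
      rw [← K₀.two_mul_vertCount h0 h1]
      by_cases hr : y < 0 ∨ m ≤ y
      · rw [K₀.vertCount_of_row hr]
        by_contra h0
        obtain ⟨s, rfl, -, -⟩ := (hN y x _ (by omega)).1 le_rfl
        have := s.k.2
        omega
      · obtain ⟨k, rfl⟩ := exists_row (m := m) (y := y) (by omega) (by omega)
        rw [K₀.vertCount_eq_ord k le_rfl]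
        have h2 := K₀.ord_nonneg k
        have h3 : (N k x : ℤ) ≤ S.ord k := by
          by_cases h0 : N k x = 0
          · omega
          · obtain ⟨s, hs, hsj, -⟩ := (hN k x _ (by omega)).1 le_rfl
            have h4 := s.le_ord
            rw [show s.k = k from Fin.ext (by omega)] at h4
            omega
        by_cases h4 : S.ord k ≤ 0
        · omega
        · have h5 := (hN k x (S.ord k).toNat (by omega)).2
            ⟨⟨k, (S.ord k).toNat, by omega, by omega⟩, rfl, rfl, (hXR _).trans hx⟩
          omega)
  refine ⟨K, fun s => ?_⟩
  have hXs : S.left s.k + 2 * (((h s + s.j : ℕ) : ℤ) - 1) = X s := by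
    simp only [X]; push_cast; ring
  -- The count jumps from `j - 1` to `j` exactly at `X s`.
  have hs1 := (hN s.k (X s) s.j s.one_le).2 ⟨s, rfl, rfl, le_rfl⟩
  have hs2 : ¬ s.j + 1 ≤ N s.k (X s) := by
    intro hlt
    obtain ⟨s', hk', hj', hx'⟩ := (hN s.k (X s) (s.j + 1) (by omega)).1 hlt
    obtain ⟨r, t, hr, hrj, hrt, hts⟩ := s'.exists_lt_same_row K₀ (by have := s.one_le; omega)
    have hrs : r = s := Dib.ext (hr.trans (Fin.ext (by omega))) (by omega)
    have h5 := hX _ _ hrt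
    have h6 := hX _ _ hts
    rw [hrs] at h5
    omega
  have hs3 : ¬ s.j ≤ N s.k (X s - 1) := by
    intro hle
    obtain ⟨s', hk', hj', hx'⟩ := (hN s.k (X s - 1) s.j s.one_le).1 hle
    have hrs : s' = s := Dib.ext (Fin.ext (by omega)) hj'
    rw [hrs] at hx'
    omega
  have h1 := K.vertCount_sub_one s.k (X s)
  have h2 := K.vert_eq_zero_or_one s.k (X s)
  rw [hK, hK] at h1
  refine K.pos_eq_of_vertCount s _ ?_ ?_
  · rw [hXs]; omega
  · rw [hXs, hK]; omega

end RegularStrip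

/-! ### Order-preserving maps versus strict maps on subsets -/

namespace RegularStrip

variable {m n : ℕ} {S : RegularStrip m n}

/-- Supplies the well-foundedness behind the induction in `exists_mem_properDibs`. -/
instance : Finite S.Dib := by
  refine Finite.of_injective (β := Σ k : Fin m, Fin ((S.ord k).toNat + 1))
    (fun s => ⟨s.k, s.j, by have := s.le_ord; omega⟩) ?_
  rintro ⟨k, j, h1, h2⟩ ⟨k', j', h1', h2'⟩ h
  rw [Sigma.mk.injEq] at h
  obtain ⟨rfl, h⟩ := h
  simpa using h

theorem Dib.lt_of_cover {s t : S.Dib} (h : s.Cover t) : s < t := Relation.TransGen.single h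

theorem Dib.exists_le_cover_of_lt {s t : S.Dib} (h : s < t) : ∃ u, s ≤ u ∧ u.Cover t := by
  have h : Relation.TransGen Dib.Cover s t := h
  cases h with
  | single h => exact ⟨s, le_rfl, h⟩
  | tail h1 h2 => exact ⟨_, h1.to_reflTransGen, h2⟩

namespace Kekule

theorem shift_lt_of_mem_properDibs (K : S.Kekule) {s t : S.Dib} (ht : t ∈ K.properDibs)
    (h : s < t) : K.shift s < K.shift t := by
  obtain ⟨u, hu, hut⟩ := Dib.exists_le_cover_of_lt h
  exact (K.shift_mono hu).trans_lt (((K.mem_properDibs_iff t).1 ht).2 u hut)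

/-- Outside the proper dibs, a positive shift is shared with some dib directly below; descending at
constant shift must end at a proper dib. -/
theorem exists_mem_properDibs (K : S.Kekule) (s : S.Dib) :
    K.shift s = 0 ∨ ∃ t ∈ K.properDibs, t ≤ s ∧ K.shift t = K.shift s := by
  induction s using WellFoundedLT.induction with
  | ind s ih =>
    by_cases hs : s ∈ K.properDibs
    · exact Or.inr ⟨s, hs, le_rfl, rfl⟩
    by_cases h0 : K.shift s = 0
    · exact Or.inl h0
    rw [mem_properDibs_iff] at hs
    push Not at hs
    obtain ⟨u, hus, hle⟩ := hs (Nat.pos_of_ne_zero h0)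
    have heq := le_antisymm hle (K.shift_le_of_cover hus)
    have hlt := Dib.lt_of_cover hus
    rcases ih u hlt with h | ⟨t, ht, htu, h⟩
    · exact absurd (heq.trans h) h0
    · exact Or.inr ⟨t, ht, htu.trans hlt.le, h.trans heq.symm⟩

/-- The order-preserving map on the dibs in proper sextets which is given by the shifts. -/
noncomputable def properShift (K : S.Kekule) (s : K.properDibs) : Set.Icc 1 n :=
  ⟨K.shift s, ((K.mem_properDibs_iff s).1 s.2).1, K.shift_le s⟩

theorem properShift_strictMono (K : S.Kekule) : StrictMono K.properShift :=
  fun _ t h => K.shift_lt_of_mem_properDibs t.2 h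

theorem corresponds_properShift (K : S.Kekule) : K.Corresponds K.properDibs K.properShift := by
  refine ⟨fun s => K.pos_eq_shift_add s, fun s hs => ⟨K.shift s, ⟨?_, ?_⟩, K.pos_eq_shift_add s⟩,
    rfl⟩
  · rcases K.exists_mem_properDibs s with h | ⟨t, ht, hts, h⟩
    · exact Or.inr h
    · refine Or.inl ⟨⟨t, ht⟩, lt_of_le_of_ne hts ?_, h⟩
      rintro rfl
      exact hs ht
  · rintro v (⟨t, hts, rfl⟩ | rfl)
    · exact K.shift_mono hts.le
    · exact Nat.zero_le _

theorem Corresponds.eq_kekule {K K' : S.Kekule} {A : Set S.Dib} {μ : A → Set.Icc 1 n}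
    (h : K.Corresponds A μ) (h' : K'.Corresponds A μ) : K = K' := by
  refine ext_of_pos fun s => ?_
  by_cases hs : s ∈ A
  · rw [h.1 ⟨s, hs⟩, h'.1 ⟨s, hs⟩]
  · obtain ⟨M, hM, h1⟩ := h.2.1 s hs
    obtain ⟨M', hM', h1'⟩ := h'.2.1 s hs
    rw [h1, h1', hM.unique hM']

/-- The pair is recovered from `K`, which yields surjectivity of the map to pairs. -/
theorem Corresponds.eq_properShift {K : S.Kekule} {A : Set S.Dib} {μ : A → Set.Icc 1 n}
    (h : K.Corresponds A μ) (hμ : StrictMono μ) :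
    (⟨K.properDibs, K.properShift, K.properShift_strictMono⟩ :
      Σ A : Set S.Dib, {μ : A → Set.Icc 1 n // StrictMono μ}) = ⟨A, μ, hμ⟩ := by
  obtain rfl := h.2.2
  have : K.properShift = μ := by
    funext s
    have h1 := h.1 s
    rw [K.pos_eq_shift_add s] at h1
    exact Subtype.ext (Nat.add_right_cancel h1)
  subst this
  rfl

theorem exists_corresponds (K₀ : S.Kekule) (A : Set S.Dib) (μ : A → Set.Icc 1 n)
    (hμ : StrictMono μ) : ∃ K : S.Kekule, K.Corresponds A μ := by
  -- Using `≤` instead of `<` lets one formula cover all dibs: on `A` the maximum is `μ` itself, and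
  -- off `A` the two sets agree.
  let D : S.Dib → Set ℕ := fun s => {v | ∃ t : A, (t : S.Dib) ≤ s ∧ (μ t : ℕ) = v} ∪ {0}
  have hDn : ∀ s, n ∈ upperBounds (D s) := by
    rintro s v (⟨t, -, rfl⟩ | rfl)
    · exact (μ t).2.2
    · exact Nat.zero_le _
  have hD : ∀ s, IsGreatest (D s) (sSup (D s)) := fun s =>
    ⟨Nat.sSup_mem ⟨0, Or.inr rfl⟩ ⟨n, hDn s⟩, fun v hv => le_csSup ⟨n, hDn s⟩ hv⟩
  have hmono : ∀ s t : S.Dib, s ≤ t → sSup (D s) ≤ sSup (D t) := by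
    intro s t hst
    refine (hD t).2 ?_
    rcases (hD s).1 with ⟨u, hu, h⟩ | h
    · exact Or.inl ⟨u, hu.trans hst, h⟩
    · exact Or.inr h
  have hA : ∀ s : A, sSup (D s) = μ s := by
    intro s
    refine (hD s).unique ⟨Or.inl ⟨s, le_rfl, rfl⟩, ?_⟩
    rintro v (⟨t, hts, rfl⟩ | rfl)
    · exact hμ.monotone hts
    · exact Nat.zero_le _
  have hnA : ∀ s : S.Dib, s ∉ A →
      {v : ℕ | ∃ t : A, (t : S.Dib) < s ∧ (μ t : ℕ) = v} ∪ {0} = D s := by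
    intro s hs
    ext v
    refine or_congr (exists_congr fun t => and_congr_left fun _ => ⟨le_of_lt, fun h => ?_⟩) Iff.rfl
    refine lt_of_le_of_ne h ?_
    rintro rfl
    exact hs t.2
  obtain ⟨K, hK⟩ := exists_kekule_of_shift K₀ (fun s => sSup (D s)) (fun s => hDn s (hD s).1)
    (fun s t hst => hmono s t (Dib.lt_of_cover hst).le)
  have hshift : ∀ s, K.shift s = sSup (D s) := fun s => by rw [shift, hK, Nat.add_sub_cancel]
  refine ⟨K, fun s => by rw [hK, hA], fun s hs => ⟨sSup (D s), ?_, hK s⟩, ?_⟩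
  · rw [hnA s hs]
    exact hD s
  · ext s
    rw [mem_properDibs_iff]
    simp only [hshift]
    constructor
    · rintro ⟨h0, h1⟩
      by_contra hs
      -- Off `A` a positive maximum comes from some `t < s` and is thus already attained at a dib
      -- directly below `s`, against strictness there.
      have hg : sSup (D s) ∈ {v : ℕ | ∃ t : A, (t : S.Dib) < s ∧ (μ t : ℕ) = v} ∪ {0} := by
        rw [hnA s hs]
        exact (hD s).1
      rcases hg with ⟨t, hts, h⟩ | h
      · obtain ⟨u, htu, hus⟩ := Dib.exists_le_cover_of_lt hts
        have h2 := h1 u hus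
        have h3 := hmono _ _ htu
        rw [hA, h] at h3
        omega
      · have h : sSup (D s) = 0 := h
        omega
    · intro hs
      have h2 := hA ⟨s, hs⟩
      simp only at h2
      rw [h2]
      refine ⟨(μ ⟨s, hs⟩).2.1, fun t ht => ?_⟩
      rcases (hD t).1 with ⟨u, hut, h⟩ | h
      · rw [← h]
        exact hμ (show u < ⟨s, hs⟩ from hut.trans_lt (Dib.lt_of_cover ht))
      · have h : sSup (D t) = 0 := h
        rw [h]
        exact (μ ⟨s, hs⟩).2.1

end Kekule

end RegularStrip

theorem mainTheorem3 {m n : ℕ} (S : RegularStrip m n) (hS : Nonempty S.Kekule) :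
    (∀ (A : Set S.Dib) (μ : A → Set.Icc 1 n), StrictMono μ →
      ∃! K : S.Kekule, K.Corresponds A μ) ∧
    (∃ Φ : S.Kekule ≃ (Σ A : Set S.Dib, {μ : A → Set.Icc 1 n // StrictMono μ}),
      ∀ K : S.Kekule, K.Corresponds (Φ K).1 (Φ K).2.1) := by
  obtain ⟨K₀⟩ := hS
  refine ⟨fun A μ hμ => ?_, ?_⟩
  · obtain ⟨K, hK⟩ := K₀.exists_corresponds A μ hμ
    exact ⟨K, hK, fun K' hK' => hK'.eq_kekule hK⟩
  · refine ⟨Equiv.ofBijective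
      (fun K => ⟨K.properDibs, K.properShift, K.properShift_strictMono⟩) ⟨?_, ?_⟩,
      fun K => K.corresponds_properShift⟩
    · intro K K' h
      -- Generalising over the pair allows substitution in place of a transport along an equality of
      -- dependent pairs.
      have key : ∀ p : Σ A : Set S.Dib, {μ : A → Set.Icc 1 n // StrictMono μ},
          p = ⟨K.properDibs, K.properShift, K.properShift_strictMono⟩ →
          K.Corresponds p.1 p.2.1 := by
        rintro _ rfl
        exact K.corresponds_properShift
      exact (key _ h.symm).eq_kekule K'.corresponds_properShift
    · rintro ⟨A, μ, hμ⟩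
      obtain ⟨K, hK⟩ := K₀.exists_corresponds A μ hμ
      exact ⟨K, hK.eq_properShift hμ⟩
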